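/- **Setting.** Let $a_1<0<a_2$, $\delta>0$, $\Omega=(a_1,a_2)$, $\Omega_I=(a_1-\delta,a_1]\cup[a_2,a_2+\delta)$. For a kernel $K:\mathbb R\to\mathbb R$ put $$Lu(x)=\int_{\Omega\cup\Omega_I}(u(y)-u(x))\,K(|x-y|)\,dy .$$ Assume: (A1) $K$ is even, nonnegative, integrable, and $K(x)=0$ for $|x|\ge\delta$; (A2) $K$ is $C^\infty$ on $(-\delta,0)$ and on $(0,\delta)$ and has finite one-sided limits $K(-\delta^+)$, $K(\delta^-)$ (so $K$ may jump at $\pm\delta$). A function $g$ satisfies (B) on an interval $(c,d)\ni 0$, with order $N\in\mathbb N$, if $g$ has a jump discontinuity at $0$ (its one-sided limits at $0$ exist, are finite and differ), $g$ is $C^N$ on $(c,0)$ and on $(0,d)$, and $g,g',\dots,g^{(N)}$ are bounded on $(c,0)\cup(0,d)$. All derivatives of $K$ are classical derivatives on $\mathbb R\setminus\{0,\pm\delta\}$ (hence defined almost everywhere). For a function $g$ defined near $0$, $x\neq0$, "$|g(0^\pm)|=\infty$" means: $g$ is unbounded on every interval $(-\varepsilon,0)$ and on every interval $(0,\varepsilon)$;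 and if moreover $|K^{(j)}(x)|\to\infty$ as $x\to0$, then also $|g(x)|\to\infty$ as $x\to0^-$ and as $x\to0^+$. **Theorem.** Let $j\ge0$ and $N\ge j+1$ be integers. Suppose that $K$ satisfies (A1) and (A2), that $K,K',\dots,K^{(j-1)}\in L^\infty(\mathbb R)$, that $K^{(j)}\in L^2(\mathbb R)$, and that $K^{(j)}$ is singular at the origin, i.e. unbounded on every interval $(-\varepsilon,0)$ and on every interval $(0,\varepsilon)$. 1. Suppose that at least one of the following holds: (i) $\pm j\delta\in\Omega$ (automatic for $j=0$); (ii) $K^{(i)}(\delta^-)=0$ for all $0\le i<j$, and $a_1\ne-\delta$, $a_2\ne\delta$. Let $f$ satisfy (B) on $\Omega$ with order $N$, let $b\in W^{1,2}(\Omega_I)$ (on the interior of $\Omega_I$), and let $u\in L^2(\Omega\cup\Omega_I)$ satisfy $Lu=f$ a.e. in $\Omega$ and $u=b$ a.e. in $\Omega_I$. Then $u$ agrees a.e. in $\Omega$ with a function that is $C^{j+1}$ on $(-\varepsilon,0)$ and on $(0,\varepsilon)$ for some $\varepsilon>0$, and for this representative $$|u^{(j+1)}(0^\pm)|=\infty .$$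 2. Let $u\in L^2(\Omega\cup\Omega_I)$ satisfy (B) with order $N$ on an interval $(c_1,c_2)$ with $[-\delta,\delta]\subset(c_1,c_2)\subseteq(a_1-\delta,a_2+\delta)$ (for instance on $\Omega\cup\Omega_I$; or on $\Omega$ if $\pm\delta\in\Omega$). Then $f:=Lu$ is $C^{j+1}$ on $(-\varepsilon,0)$ and on $(0,\varepsilon)$ for some $\varepsilon>0$, and $$|f^{(j+1)}(0^\pm)|=\infty .$$ -/

import Mathlib

open MeasureTheory Set Filter
open scoped Topology ContDiff

noncomputable section

/-- The domain `Ω = (a₁, a₂)`. -/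
def nlDomain (a₁ a₂ : ℝ) : Set ℝ := Ioo a₁ a₂

/-- The collar `Ω_I = (a₁ - δ, a₁] ∪ [a₂, a₂ + δ)`. -/
def nlCollar (a₁ a₂ δ : ℝ) : Set ℝ := Ioc (a₁ - δ) a₁ ∪ Ico a₂ (a₂ + δ)

/-- `(L u)(x) = ∫_{Ω ∪ Ω_I} (u(y) - u(x)) K(|x - y|) dy`. -/
def nlLaplacian (K : ℝ → ℝ) (a₁ a₂ δ : ℝ) (u : ℝ → ℝ) (x : ℝ) : ℝ :=
  ∫ y in nlDomain a₁ a₂ ∪ nlCollar a₁ a₂ δ, (u y - u x) * K |x - y|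

/-- Assumption (A1): the kernel is even (radial), nonnegative, integrable, and vanishes for
`|x| ≥ δ`. -/
structure KernelA1 (K : ℝ → ℝ) (δ : ℝ) : Prop where
  radial : ∀ x, K (-x) = K x
  nonneg : ∀ x, 0 ≤ K x
  support : ∀ x, δ ≤ |x| → K x = 0
  integrable : Integrable K

/-- Assumption (A2): the kernel is smooth on `(-δ, 0)` and on `(0, δ)`, and extends continuously
to `[-δ, 0)` and to `(0, δ]`. The kernel itself may jump at `±δ`. -/
structure KernelA2 (K : ℝ → ℝ) (δ : ℝ) : Prop where
  smooth_left : ContDiffOn ℝ ∞ K (Ioo (-δ) 0)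
  smooth_right : ContDiffOn ℝ ∞ K (Ioo 0 δ)
  limit_left : ∃ l : ℝ, Tendsto K (𝓝[>] (-δ)) (𝓝 l)
  limit_right : ∃ l : ℝ, Tendsto K (𝓝[<] δ) (𝓝 l)

/-- Assumption (B) on the interval `(c, d)`: the function has a jump discontinuity at `0`, it is
`C^N` on `(c, 0)` and on `(0, d)`, and all its derivatives of order at most `N` are bounded there. -/
structure AssumptionB (N : ℕ) (c d : ℝ) (g : ℝ → ℝ) : Prop where
  jump : ∃ l r : ℝ, Tendsto g (𝓝[<] 0) (𝓝 l) ∧ Tendsto g (𝓝[>] 0) (𝓝 r) ∧ l ≠ r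
  smooth_left : ContDiffOn ℝ N g (Ioo c 0)
  smooth_right : ContDiffOn ℝ N g (Ioo 0 d)
  bounded : ∀ i ≤ N, ∃ M : ℝ, ∀ x ∈ Ioo c 0 ∪ Ioo 0 d, |iteratedDeriv i g x| ≤ M

/-- The Sobolev space `W^{1,2}(U)` of an open set `U ⊆ ℝ`: `g ∈ L²(U)` has a weak derivative
`g' ∈ L²(U)`. -/
def MemW12 (U : Set ℝ) (g : ℝ → ℝ) : Prop :=
  MemLp g 2 (volume.restrict U) ∧
    ∃ g' : ℝ → ℝ, MemLp g' 2 (volume.restrict U) ∧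
      ∀ φ : ℝ → ℝ, ContDiff ℝ ∞ φ → HasCompactSupport φ → tsupport φ ⊆ U →
        ∫ x in U, g x * deriv φ x = - ∫ x in U, g' x * φ x

/-- `u ∈ L²(Ω ∪ Ω_I)` solves `L u = f` in `Ω`, `u = b` in `Ω_I` (almost everywhere). -/
structure IsNlSolution (K : ℝ → ℝ) (a₁ a₂ δ : ℝ) (f b u : ℝ → ℝ) : Prop where
  memLp : MemLp u 2 (volume.restrict (nlDomain a₁ a₂ ∪ nlCollar a₁ a₂ δ))
  eqn : ∀ᵐ x ∂(volume.restrict (nlDomain a₁ a₂)), nlLaplacian K a₁ a₂ δ u x = f x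
  constraint : ∀ᵐ x ∂(volume.restrict (nlCollar a₁ a₂ δ)), u x = b x

/-- `g` is `C^n` on `(-ε, 0)` and on `(0, ε)` for some `ε > 0`. -/
def ContDiffOffZero (n : ℕ) (g : ℝ → ℝ) : Prop :=
  ∃ ε > 0, ContDiffOn ℝ n g (Ioo (-ε) 0) ∧ ContDiffOn ℝ n g (Ioo 0 ε)

/-- `g` is unbounded on every left and on every right punctured neighbourhood of `0`. -/
def UnboundedAtZero (g : ℝ → ℝ) : Prop :=
  (∀ M : ℝ, ∃ᶠ x in 𝓝[<] 0, M < |g x|) ∧ (∀ M : ℝ, ∃ᶠ x in 𝓝[>] 0, M < |g x|)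

/-- `|g(0⁻)| = ∞` and `|g(0⁺)| = ∞` as one-sided limits. -/
def InfiniteAtZero (g : ℝ → ℝ) : Prop :=
  Tendsto (fun x => |g x|) (𝓝[<] 0) atTop ∧ Tendsto (fun x => |g x|) (𝓝[>] 0) atTop

end

open MeasureTheory Set Filter
open scoped Topology ContDiff

noncomputable section

/-! Let κ = ∫ K > 0 and let U be u extended by zero from Ω ∪ Ω_I. Since K lives on [-δ, δ], Lu = K *
U - κ u on Ω (`nlLaplacian_eq`). If U is a.e. a primitive of some w in L¹ ∩ L² plus finitely many
jumps c_p at points p, then K * U is a primitive of K * w + Σ c_p K(· - p)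
(`PiecewisePrimitive.realConv_eq`). The jump at 0 contributes c_0 K, whose j-th derivative is
singular at 0; if all other terms have j bounded derivatives on a punctured neighbourhood of 0, the
singularity survives in order j + 1 (`KernelA1.singular_of_eq_primitive`). Part 2 applies this to Lu
= K * U - κ u, with U cut off to (c₁, c₂); part 1 applies it to u = κ⁻¹ (K * U - f), where a jump of
f forces a jump of u because K * U is continuous.

Two facts remain. The first is the regularity of K * w. Derivatives are put on K until K^(j) * w is
reached, which is bounded because both factors are in L². But K^(i) may jump at 0 and ±δ, so each
differentiation also emits multiples of w(x - q), q ∈ {0, δ, -δ}, and w must be regular at the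
shifted points (`KernelTower.smoothBdd_realConv`). In part 2 this is assumption (B). In part 1, w
solves κ w = K * w + Σ c_p K(· - p) - f', and a bootstrap gains one derivative per round
(`KernelTower.smoothBdd_of_equation`). Each round shrinks the interval by δ at both ends, so j
rounds fit when ±jδ ∈ Ω; if the K^(i), i < j, vanish at δ⁻, only the shift q = 0 occurs and nothing
is lost.

The second, needed in part 1, is that U is a piecewise primitive although u is only in L². On the
collar this is the one-dimensional Sobolev theory of b. On Ω it suffices that K * U has an L²
derivative. The increment d of u·1_Ω over a step η satisfies κ|d| ≤ K * |d| + G with ‖G‖₁ = O(η).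
Testing against the parabola C - x², for which K * (C - x²) = κ (C - x²) - m with m = ∫ K t² > 0,
yields m ‖d‖₁ ≤ C ‖G‖₁ (`KernelA1.exists_integral_abs_le`). So U has bounded L¹ difference
quotients. Paired with K * ψ they form bounded functionals of ψ ∈ L², and the Riesz representation
of a limit is the derivative of K * U (`exists_memLp_integral_eq_of_diff_le`). -/

/-- Convolution of real functions on the line. -/
def realConv (k g : ℝ → ℝ) (x : ℝ) : ℝ := ∫ t, k t * g (x - t)

/-- The primitive of `w` vanishing at `-∞`. -/
def primitive (w : ℝ → ℝ) (x : ℝ) : ℝ := ∫ t in Iic x, w t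

/-- The real `L²` norm on the line. -/
def normL2 (g : ℝ → ℝ) : ℝ := (eLpNorm g 2 volume).toReal

/-- The Heaviside jump function of the finite point set `S` with jumps `c`. -/
def jumpSum (S : Finset ℝ) (c : ℝ → ℝ) (x : ℝ) : ℝ := ∑ p ∈ S, c p * (if p < x then 1 else 0)

/-! ### Convolution: bounds, continuity, symmetry -/

theorem realConv_comm (k g : ℝ → ℝ) (x : ℝ) : realConv k g x = realConv g k x := by
  unfold realConv
  rw [← integral_sub_left_eq_self (fun t => k t * g (x - t)) volume x]
  simp [mul_comm]

theorem realConv_congr_right {g g' : ℝ → ℝ} (k : ℝ → ℝ) (h : g =ᵐ[volume] g') :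
    realConv k g = realConv k g' := by
  ext x
  rw [realConv_comm, realConv_comm k g' x]
  exact integral_congr_ae (h.mono fun t ht => by simp only [ht])

theorem memLp_comp_sub_left {g : ℝ → ℝ} {p : ENNReal} (hg : MemLp g p) (x : ℝ) :
    MemLp (fun t => g (x - t)) p :=
  hg.comp_measurePreserving (Measure.measurePreserving_sub_left volume x)

theorem eLpNorm_comp_sub_left {g : ℝ → ℝ} {p : ENNReal} (hg : AEStronglyMeasurable g) (x : ℝ) :
    eLpNorm (fun t => g (x - t)) p volume = eLpNorm g p volume :=
  eLpNorm_comp_measurePreserving hg (Measure.measurePreserving_sub_left volume x)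

theorem abs_integral_mul_le_normL2 {k g : ℝ → ℝ} (hk : MemLp k 2) (hg : MemLp g 2) :
    Integrable (fun t => k t * g t) ∧ |∫ t, k t * g t| ≤ normL2 k * normL2 g := by
  have h1 : MemLp (fun t => k t * g t) 1 := hg.mul' (r := 1) hk
  refine ⟨memLp_one_iff_integrable.1 h1, ?_⟩
  have h2 : eLpNorm (fun t => k t * g t) 1 volume ≤ eLpNorm k 2 volume * eLpNorm g 2 volume := by
    have := eLpNorm_smul_le_mul_eLpNorm (p := 2) (q := 2) (r := 1) hg.1 hk.1
    simp only [smul_eq_mul] at this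
    convert this using 2; rfl
  calc |∫ t, k t * g t| ≤ ∫ t, |k t * g t| := abs_integral_le_integral_abs
    _ = (eLpNorm (fun t => k t * g t) 1 volume).toReal := by
        rw [eLpNorm_one_eq_lintegral_enorm]
        exact integral_norm_eq_lintegral_enorm h1.1
    _ ≤ (eLpNorm k 2 volume * eLpNorm g 2 volume).toReal :=
        ENNReal.toReal_mono (ENNReal.mul_ne_top hk.2.ne hg.2.ne) h2
    _ = _ := ENNReal.toReal_mul

theorem abs_realConv_le {k g : ℝ → ℝ} (hk : MemLp k 2) (hg : MemLp g 2) (x : ℝ) :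
    |realConv k g x| ≤ normL2 k * normL2 g := by
  have := (abs_integral_mul_le_normL2 hk (memLp_comp_sub_left hg x)).2
  rwa [normL2, normL2, eLpNorm_comp_sub_left hg.1] at this

theorem integrable_realConv_integrand {k g : ℝ → ℝ} (hk : MemLp k 2) (hg : MemLp g 2) (x : ℝ) :
    Integrable (fun t => k t * g (x - t)) :=
  (abs_integral_mul_le_normL2 hk (memLp_comp_sub_left hg x)).1

theorem normL2_nonneg (g : ℝ → ℝ) : 0 ≤ normL2 g := ENNReal.toReal_nonneg

/-- Continuous compactly supported functions approximate `k` in L²; by Cauchy–Schwarz the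
convolutions with `g` then converge uniformly. -/
theorem continuous_realConv {k g : ℝ → ℝ} (hk : MemLp k 2) (hg : MemLp g 2) :
    Continuous (realConv k g) := by
  have key : ∀ n : ℕ, ∃ h : ℝ → ℝ, Continuous (realConv h g) ∧ MemLp h 2 ∧
      normL2 (k - h) ≤ 1 / (n + 1) := by
    intro n
    obtain ⟨h, hc, hle, hcont, hmem⟩ := hk.exists_hasCompactSupport_eLpNorm_sub_le (by simp)
      (ε := ENNReal.ofReal (1 / ((n : ℝ) + 1))) (by simp; positivity)
    refine ⟨h, ?_, hmem, ENNReal.toReal_le_of_le_ofReal (by positivity) hle⟩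
    exact hc.continuous_convolution_left (ContinuousLinearMap.mul ℝ ℝ) hcont
      (hg.locallyIntegrable (by norm_num))
  choose h hcont hmem hle using key
  have hu : TendstoUniformly (fun n => realConv (h n) g) (realConv k g) atTop := by
    rw [Metric.tendstoUniformly_iff]
    intro ε hε
    have hl : Tendsto (fun n : ℕ => 1 / ((n : ℝ) + 1) * normL2 g) atTop (𝓝 0) := by
      simpa using tendsto_one_div_add_atTop_nhds_zero_nat.mul_const (normL2 g)
    filter_upwards [hl.eventually_lt_const hε] with n hn x
    rw [Real.dist_eq]
    have : realConv k g x - realConv (h n) g x = realConv (k - h n) g x := by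
      unfold realConv
      rw [← integral_sub (integrable_realConv_integrand hk hg x)
        (integrable_realConv_integrand (hmem n) hg x)]
      simp [sub_mul]
    rw [this]
    exact ((abs_realConv_le (hk.sub (hmem n)) hg x).trans
      (mul_le_mul_of_nonneg_right (hle n) (normL2_nonneg g))).trans_lt hn
  exact hu.continuous (Frequently.of_forall hcont)

theorem realConv_sub_right {k g g' : ℝ → ℝ} (hk : MemLp k 2) (hg : MemLp g 2) (hg' : MemLp g' 2)
    (x : ℝ) : realConv k (fun y => g y - g' y) x = realConv k g x - realConv k g' x := by
  unfold realConv
  rw [← integral_sub (integrable_realConv_integrand hk hg x)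
    (integrable_realConv_integrand hk hg' x)]
  simp [mul_sub]

theorem realConv_add_right {k g g' : ℝ → ℝ} (hk : MemLp k 2) (hg : MemLp g 2) (hg' : MemLp g' 2)
    (x : ℝ) : realConv k (fun y => g y + g' y) x = realConv k g x + realConv k g' x := by
  unfold realConv
  rw [← integral_add (integrable_realConv_integrand hk hg x)
    (integrable_realConv_integrand hk hg' x)]
  simp [mul_add]

theorem realConv_comp_add (k g : ℝ → ℝ) (h x : ℝ) :
    realConv k (fun y => g (y + h)) x = realConv k g (x + h) := by
  unfold realConv
  congr 1; ext t; simp only [show x - t + h = x + h - t by ring]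

theorem integrable_realConv {k g : ℝ → ℝ} (hk : Integrable k) (hg : Integrable g) :
    Integrable (realConv k g) :=
  hk.integrable_convolution (ContinuousLinearMap.mul ℝ ℝ) hg

theorem integral_realConv {k g : ℝ → ℝ} (hk : Integrable k) (hg : Integrable g) :
    ∫ x, realConv k g x = (∫ x, k x) * ∫ x, g x :=
  integral_convolution (ContinuousLinearMap.mul ℝ ℝ) hk hg

theorem abs_realConv_le_realConv_abs (k g : ℝ → ℝ) (x : ℝ) :
    |realConv k g x| ≤ realConv (fun t => |k t|) (fun t => |g t|) x := by
  unfold realConv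
  simp_rw [← abs_mul]
  exact abs_integral_le_integral_abs

theorem integral_abs_realConv_le {k g : ℝ → ℝ} (hk : Integrable k) (hg : Integrable g) :
    ∫ x, |realConv k g x| ≤ (∫ x, |k x|) * ∫ x, |g x| := by
  rw [← integral_realConv hk.abs hg.abs]
  exact integral_mono (integrable_realConv hk hg).abs (integrable_realConv hk.abs hg.abs)
    (abs_realConv_le_realConv_abs k g)

theorem integrable_prod_realConv {k g : ℝ → ℝ} (hk : Integrable k) (hg : Integrable g) :
    Integrable (fun z : ℝ × ℝ => k z.2 * g (z.1 - z.2)) (volume.prod volume) :=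
  hk.convolution_integrand (ContinuousLinearMap.mul ℝ ℝ) hg

/-- Convolution with an even kernel is symmetric. -/
theorem integral_mul_realConv_symm {k g ψ : ℝ → ℝ} (hk : Integrable k) (hg : Integrable g)
    (heven : ∀ x, k (-x) = k x) (hψ : AEStronglyMeasurable ψ) {M : ℝ} (hM : ∀ x, |ψ x| ≤ M) :
    ∫ x, ψ x * realConv k g x = ∫ y, g y * realConv k ψ y := by
  have h0 : Integrable (fun z : ℝ × ℝ => g z.2 * k (z.1 - z.2)) (volume.prod volume) :=
    integrable_prod_realConv hg hk
  have h1 : Integrable (fun z : ℝ × ℝ => ψ z.1 * (g z.2 * k (z.1 - z.2)))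
      (volume.prod volume) :=
    h0.bdd_mul (c := M) hψ.comp_fst (Eventually.of_forall fun z => hM z.1)
  calc ∫ x, ψ x * realConv k g x = ∫ x, ∫ y, ψ x * (g y * k (x - y)) := by
        congr 1; ext x
        rw [realConv_comm, realConv, integral_const_mul]
    _ = ∫ y, ∫ x, ψ x * (g y * k (x - y)) := integral_integral_swap h1
    _ = ∫ y, g y * realConv k ψ y := by
        congr 1; ext y
        rw [realConv_comm, realConv, ← integral_const_mul]
        congr 1; ext x
        rw [← heven (y - x), neg_sub]; ring

/-! ### Primitives and piecewise primitives -/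

theorem primitive_sub_primitive {w : ℝ → ℝ} (hw : Integrable w) (a b : ℝ) :
    primitive w b - primitive w a = ∫ t in a..b, w t :=
  (intervalIntegral.integral_Iic_sub_Iic hw.integrableOn hw.integrableOn)

theorem primitive_congr {w w' : ℝ → ℝ} (h : w =ᵐ[volume] w') : primitive w = primitive w' := by
  ext x; exact integral_congr_ae (ae_restrict_of_ae h)

theorem continuous_primitive {w : ℝ → ℝ} (hw : Integrable w) : Continuous (primitive w) := by
  have : primitive w = fun x => primitive w 0 + ∫ t in (0 : ℝ)..x, w t := by
    ext x; rw [← primitive_sub_primitive hw]; ring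
  rw [this]
  exact continuous_const.add (intervalIntegral.continuous_primitive
    (fun a b => hw.intervalIntegrable) 0)

theorem hasDerivAt_primitive {w : ℝ → ℝ} (hw : Integrable w) {x : ℝ} (hx : ContinuousAt w x) :
    HasDerivAt (primitive w) (w x) x := by
  have : primitive w = fun x => primitive w 0 + ∫ t in (0 : ℝ)..x, w t := by
    ext x; rw [← primitive_sub_primitive hw]; ring
  rw [this]
  exact (intervalIntegral.integral_hasDerivAt_right hw.intervalIntegrable
    hw.1.stronglyMeasurableAtFilter hx).const_add _

theorem realConv_primitive {k w : ℝ → ℝ} (hk : Integrable k) (hw : Integrable w) (x : ℝ) :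
    realConv k (primitive w) x = primitive (realConv k w) x := by
  have h1 : Integrable (fun z : ℝ × ℝ => k z.2 * w (z.1 - z.2))
      ((volume.restrict (Iic x)).prod volume) :=
    (integrable_prod_realConv hk hw).mono_measure
      (Measure.prod_mono Measure.restrict_le_self le_rfl)
  unfold realConv
  rw [primitive, integral_integral_swap h1]
  congr 1; ext t
  rw [integral_const_mul, primitive]
  congr 1
  rw [← integral_indicator measurableSet_Iic, ← integral_indicator measurableSet_Iic,
    ← integral_sub_right_eq_self _ t]
  congr 1; ext s
  simp [indicator]

theorem realConv_heaviside (k : ℝ → ℝ) (p x : ℝ) :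
    realConv k (fun y => if p < y then 1 else 0) x = primitive (fun t => k (t - p)) x := by
  unfold realConv
  rw [primitive, ← integral_indicator measurableSet_Iic,
    ← integral_sub_right_eq_self (fun t => k t * _) p]
  refine integral_congr_ae ?_
  -- After the shift the Heaviside condition is t < x, while `primitive` integrates over t ≤ x; the
  -- two differ only at t = x.
  filter_upwards [compl_mem_ae_iff.2 (measure_singleton (μ := volume) x)] with t ht
  have ht : t ≠ x := ht
  by_cases h : t < x
  · have : p < x - (t - p) := by linarith
    simp [indicator, this, h.le]
  · have h' : x < t := lt_of_le_of_ne (not_lt.1 h) ht.symm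
    have : ¬ p < x - (t - p) := by linarith
    simp [indicator, this, h']

/-- `g` agrees a.e. with the sum of the primitive of `w` and of jumps `c p` at the points
`p ∈ S`. -/
def PiecewisePrimitive (S : Finset ℝ) (c w g : ℝ → ℝ) : Prop :=
  g =ᵐ[volume] fun x => primitive w x + jumpSum S c x

theorem abs_primitive_le {w : ℝ → ℝ} (hw : Integrable w) (x : ℝ) :
    |primitive w x| ≤ ∫ t, |w t| := by
  refine (abs_integral_le_integral_abs).trans ?_
  exact setIntegral_le_integral hw.abs (Eventually.of_forall fun t => abs_nonneg _)

/-- The distributional derivative of `g` is `w` plus Dirac masses c_p at p; convolving with `k`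
turns each mass into a translate of `k`. -/
theorem PiecewisePrimitive.realConv_eq {S : Finset ℝ} {c w g k : ℝ → ℝ} (hk : Integrable k)
    (hw : Integrable w) (hg : PiecewisePrimitive S c w g) (x : ℝ) :
    realConv k g x = primitive (fun t => realConv k w t + ∑ p ∈ S, c p * k (t - p)) x := by
  rw [realConv_congr_right k hg]
  have hb : ∀ p, Integrable (fun t => k t * (c p * (if p < x - t then 1 else 0))) := by
    intro p
    refine hk.mul_bdd (c := |c p|) ?_ (Eventually.of_forall fun t => ?_)
    · exact (Measurable.const_mul (Measurable.ite (measurableSet_lt measurable_const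
        (measurable_const.sub measurable_id)) measurable_const measurable_const)
        _).aestronglyMeasurable
    · by_cases h : p < x - t <;> simp [h]
  have ha : Integrable (fun t => k t * primitive w (x - t)) := by
    refine hk.mul_bdd (c := ∫ t, |w t|) ?_ (Eventually.of_forall fun t => abs_primitive_le hw _)
    exact ((continuous_primitive hw).comp (continuous_const.sub continuous_id)).aestronglyMeasurable
  have e1 : realConv k (fun x => primitive w x + jumpSum S c x) x
      = realConv k (primitive w) x + ∑ p ∈ S, c p * primitive (fun t => k (t - p)) x := by
    unfold realConv jumpSum
    simp_rw [mul_add, Finset.mul_sum]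
    rw [integral_add ha (integrable_finsetSum _ fun p _ => hb p),
      integral_finsetSum _ fun p _ => hb p]
    congr 1
    refine Finset.sum_congr rfl fun p _ => ?_
    rw [← realConv_heaviside, realConv, ← integral_const_mul]
    congr 1; ext t; ring
  rw [e1, realConv_primitive hk hw]
  unfold primitive
  have hkp : ∀ p, Integrable (fun t => c p * k (t - p)) (volume.restrict (Iic x)) := fun p =>
    ((hk.comp_sub_right p).const_mul _).restrict
  rw [integral_add (integrable_realConv hk hw).restrict (integrable_finsetSum _ fun p _ => hkp p),
    integral_finsetSum _ fun p _ => hkp p]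
  simp_rw [integral_const_mul]

theorem integrable_realConv_add_jumps {S : Finset ℝ} {c w k : ℝ → ℝ} (hk : Integrable k)
    (hw : Integrable w) : Integrable (fun t => realConv k w t + ∑ p ∈ S, c p * k (t - p)) :=
  (integrable_realConv hk hw).add
    (integrable_finsetSum _ fun p _ => (hk.comp_sub_right p).const_mul _)

theorem PiecewisePrimitive.add {S : Finset ℝ} {c c' w w' g g' : ℝ → ℝ} (hw : Integrable w)
    (hw' : Integrable w') (hg : PiecewisePrimitive S c w g) (hg' : PiecewisePrimitive S c' w' g') :
    PiecewisePrimitive S (c + c') (fun x => w x + w' x) (fun x => g x + g' x) := by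
  filter_upwards [hg, hg'] with x h h'
  rw [h, h']
  have : primitive (fun x => w x + w' x) x = primitive w x + primitive w' x :=
    integral_add hw.restrict hw'.restrict
  simp only [jumpSum, Pi.add_apply, add_mul, Finset.sum_add_distrib, this]
  ring

/-- The restriction to an interval of a function which is a primitive there. -/
theorem PiecewisePrimitive.indicator_Ioo {S : Finset ℝ} {w g : ℝ → ℝ} {p q C : ℝ}
    (hw : Integrable w) (hpq : p < q) (hp : p ∈ S) (hq : q ∈ S)
    (hg : ∀ᵐ x, x ∈ Ioo p q → g x = C + primitive w x) :
    PiecewisePrimitive S (fun x => if x = p then C + primitive w p else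
        if x = q then -(C + primitive w q) else 0)
      ((Ioo p q).indicator w) ((Ioo p q).indicator g) := by
  filter_upwards [hg, compl_mem_ae_iff.2 (measure_singleton (μ := volume) p),
    compl_mem_ae_iff.2 (measure_singleton (μ := volume) q)] with x hx hxp hxq
  have hxp : x ≠ p := hxp
  have hxq : x ≠ q := hxq
  have e : jumpSum S (fun x => if x = p then C + primitive w p else
        if x = q then -(C + primitive w q) else 0) x =
      (C + primitive w p) * (if p < x then 1 else 0)
        - (C + primitive w q) * (if q < x then 1 else 0) := by
    unfold jumpSum
    -- Cutting off to (p, q) creates a jump from 0 up to the value at p and one back down to 0 at q;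
    -- the other points of `S` carry no jump.
    rw [← Finset.sum_subset (s₁ := {p, q}) (by
      intro z hz; simp at hz; rcases hz with rfl | rfl <;> assumption)]
    · rw [Finset.sum_pair hpq.ne]; simp [hpq.ne']; split_ifs <;> ring
    · intro z _ hz; simp at hz; simp [hz.1, hz.2]
  rw [e, primitive, integral_indicator measurableSet_Ioo,
    Measure.restrict_restrict measurableSet_Ioo]
  rcases lt_or_gt_of_ne hxp with h1 | h1
  · have : Ioo p q ∩ Iic x = ∅ := by ext z; simp; intros; linarith
    have h3 : x ∉ Ioo p q := fun h => absurd h.1 (by linarith)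
    simp [this, h3, not_lt.2 h1.le, not_lt.2 (h1.trans hpq).le]
  · have hsub : ∀ y, p ≤ y → ∫ t in Ioc p y, w t = primitive w y - primitive w p := by
      intro y hy
      rw [primitive_sub_primitive hw, intervalIntegral.integral_of_le hy]
    rcases lt_or_gt_of_ne hxq with h2 | h2
    · have : Ioo p q ∩ Iic x = Ioc p x := by
        ext z; simp only [mem_inter_iff, mem_Ioo, mem_Iic, mem_Ioc]
        exact ⟨fun h => ⟨h.1.1, h.2⟩, fun h => ⟨⟨h.1, by linarith⟩, h.2⟩⟩
      have h3 : x ∈ Ioo p q := ⟨h1, h2⟩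
      rw [this, hsub x h1.le, indicator_of_mem h3, hx h3]
      simp [h1, not_lt.2 h2.le, add_comm]
    · have : Ioo p q ∩ Iic x = Ioo p q := by
        ext z; simp; intros; linarith
      have h3 : x ∉ Ioo p q := fun h => absurd h.2 (by linarith)
      rw [this, ← integral_Ioc_eq_integral_Ioo, hsub q hpq.le, indicator_of_notMem h3]
      simp [h1, h2]

/-- `L¹` modulus of continuity of a piecewise primitive. -/
theorem PiecewisePrimitive.integral_abs_sub_le {S : Finset ℝ} {c w g : ℝ → ℝ} (hw : Integrable w)
    (hg : PiecewisePrimitive S c w g) {h : ℝ} (hh : 0 < h) :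
    Integrable (fun x => g (x + h) - g x) ∧
    ∫ x, |g (x + h) - g x| ≤ h * ((∫ x, |w x|) + ∑ p ∈ S, |c p|) := by
  -- The increment over a step h is the convolution of the derivative measure with this window. Its
  -- L¹ norm is h, so the bound is h times a bound for the total variation.
  set χ : ℝ → ℝ := (Ioc (-h) 0).indicator fun _ => 1 with hχ
  have hχi : Integrable χ := (integrable_indicator_iff measurableSet_Ioc).2
    (integrableOn_const (by simp) (by simp))
  have hχ1 : ∫ x, |χ x| = h := by
    have : (fun x => |χ x|) = χ := by
      ext x; rw [hχ]; by_cases hx : x ∈ Ioc (-h) 0 <;> simp [indicator, hx]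
    rw [this, hχ, integral_indicator measurableSet_Ioc]; simp [hh.le]
  have hp : ∀ x, primitive w (x + h) - primitive w x = realConv χ w x := by
    intro x
    rw [primitive_sub_primitive hw, intervalIntegral.integral_of_le (by linarith), realConv_comm,
      realConv, ← integral_Ico_eq_integral_Ioc, ← integral_indicator measurableSet_Ico]
    congr 1; ext t
    have : t ∈ Ico x (x + h) ↔ x - t ∈ Ioc (-h) 0 := by
      simp only [mem_Ioc, mem_Ico]; constructor <;> rintro ⟨h1, h2⟩ <;> constructor <;> linarith
    by_cases ht : t ∈ Ico x (x + h)
    · rw [indicator_of_mem ht, hχ, indicator_of_mem (this.1 ht), mul_one]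
    · rw [indicator_of_notMem ht, hχ, indicator_of_notMem (mt this.2 ht), mul_zero]
  have hj : ∀ x, jumpSum S c (x + h) - jumpSum S c x = ∑ p ∈ S, c p * χ (x - p) := by
    intro x
    unfold jumpSum
    rw [← Finset.sum_sub_distrib]
    refine Finset.sum_congr rfl fun p _ => ?_
    rw [← mul_sub]; congr 1
    rw [hχ]
    by_cases h1 : p < x
    · have h2 : x - p ∉ Ioc (-h) 0 := fun h' => absurd h'.2 (by linarith)
      have h3 : p < x + h := by linarith
      rw [indicator_of_notMem h2]; simp [h1, h3]
    · by_cases h3 : p < x + h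
      · have h2 : x - p ∈ Ioc (-h) 0 := ⟨by linarith, by linarith⟩
        rw [indicator_of_mem h2]; simp [h1, h3]
      · have h2 : x - p ∉ Ioc (-h) 0 := fun h' => absurd h'.1 (by linarith)
        rw [indicator_of_notMem h2]; simp [h1, h3]
  have hg2 : (fun x => g (x + h)) =ᵐ[volume] fun x => primitive w (x + h) + jumpSum S c (x + h) :=
    (measurePreserving_add_right volume h).quasiMeasurePreserving.ae_eq_comp hg
  have he : (fun x => g (x + h) - g x) =ᵐ[volume]
      fun x => realConv χ w x + ∑ p ∈ S, c p * χ (x - p) := by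
    filter_upwards [hg, hg2] with x h1 h2
    rw [h1, h2, ← hp, ← hj]; ring
  refine ⟨(integrable_realConv_add_jumps hχi hw).congr he.symm, ?_⟩
  rw [integral_congr_ae (he.mono fun x hx => congrArg abs hx)]
  have i1 := (integrable_realConv hχi hw).abs
  have i2 : ∀ p ∈ S, Integrable fun x => |c p| * |χ (x - p)| := fun p _ =>
    (hχi.abs.comp_sub_right p).const_mul _
  calc ∫ x, |realConv χ w x + ∑ p ∈ S, c p * χ (x - p)|
      ≤ ∫ x, (|realConv χ w x| + ∑ p ∈ S, |c p| * |χ (x - p)|) := by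
        refine integral_mono (integrable_realConv_add_jumps hχi hw).abs
          (i1.add (integrable_finsetSum _ i2)) fun x => ?_
        refine (abs_add_le _ _).trans (add_le_add le_rfl ?_)
        refine (Finset.abs_sum_le_sum_abs _ _).trans (le_of_eq ?_)
        simp_rw [abs_mul]
    _ = (∫ x, |realConv χ w x|) + ∑ p ∈ S, |c p| * h := by
        rw [integral_add i1 (integrable_finsetSum _ i2), integral_finsetSum _ i2]
        congr 1
        refine Finset.sum_congr rfl fun p _ => ?_
        rw [integral_const_mul, integral_sub_right_eq_self (fun x => |χ x|), hχ1]
    _ ≤ h * ((∫ x, |w x|) + ∑ p ∈ S, |c p|) := by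
        have := integral_abs_realConv_le hχi hw
        rw [hχ1] at this
        rw [← Finset.sum_mul, mul_add, mul_comm h (∑ p ∈ S, |c p|)]
        exact add_le_add this le_rfl

theorem PiecewisePrimitive.congr {S : Finset ℝ} {c w w' g g' : ℝ → ℝ}
    (h : PiecewisePrimitive S c w g) (hw : w =ᵐ[volume] w') (hg : g =ᵐ[volume] g') :
    PiecewisePrimitive S c w' g' := by
  unfold PiecewisePrimitive at *
  rw [← primitive_congr hw]
  exact hg.symm.trans h

theorem exists_eq_const_add_primitive {g w : ℝ → ℝ} {p q : ℝ} (hpq : p < q) (hw : Integrable w)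
    (hg : ∀ x ∈ Ioo p q, HasDerivAt g (w x) x) :
    ∃ C, ∀ x ∈ Ioo p q, g x = C + primitive w x := by
  set m := (p + q) / 2 with hm
  have hmem : m ∈ Ioo p q := ⟨by linarith, by linarith⟩
  refine ⟨g m - primitive w m, fun x hx => ?_⟩
  have hsub : uIcc m x ⊆ Ioo p q := by
    rw [← segment_eq_uIcc]; exact (convex_Ioo p q).segment_subset hmem hx
  have := intervalIntegral.integral_eq_sub_of_hasDerivAt (fun y hy => hg y (hsub hy))
    (hw.intervalIntegrable (a := m) (b := x))
  rw [← primitive_sub_primitive hw] at this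
  linarith

/-! ### Calculus of functions with bounded derivatives -/

/-- On the set `V`, the function `g` is `C^n` with bounded derivatives up to order `n`. -/
def SmoothBdd (n : ℕ) (V : Set ℝ) (g : ℝ → ℝ) : Prop :=
  ContDiffOn ℝ n g V ∧ ∀ m ≤ n, ∃ M : ℝ, ∀ x ∈ V, |iteratedDeriv m g x| ≤ M

namespace SmoothBdd

variable {n : ℕ} {V V' : Set ℝ} {g g' : ℝ → ℝ}

theorem mono (h : SmoothBdd n V g) (hV : V' ⊆ V) : SmoothBdd n V' g :=
  ⟨h.1.mono hV, fun m hm => (h.2 m hm).imp fun _ hM x hx => hM x (hV hx)⟩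

theorem of_le {m : ℕ} (h : SmoothBdd n V g) (hm : m ≤ n) : SmoothBdd m V g :=
  ⟨h.1.of_le (by exact_mod_cast hm), fun i hi => h.2 i (hi.trans hm)⟩

theorem contDiffAt (h : SmoothBdd n V g) (hV : IsOpen V) {x : ℝ} (hx : x ∈ V) {m : ℕ}
    (hm : m ≤ n) : ContDiffAt ℝ m g x :=
  (h.1.contDiffAt (hV.mem_nhds hx)).of_le (by exact_mod_cast hm)

theorem add (hV : IsOpen V) (h : SmoothBdd n V g) (h' : SmoothBdd n V g') :
    SmoothBdd n V (fun x => g x + g' x) := by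
  refine ⟨h.1.add h'.1, fun m hm => ?_⟩
  obtain ⟨M, hM⟩ := h.2 m hm
  obtain ⟨M', hM'⟩ := h'.2 m hm
  refine ⟨M + M', fun x hx => ?_⟩
  rw [iteratedDeriv_fun_add (h.contDiffAt hV hx hm) (h'.contDiffAt hV hx hm)]
  exact (abs_add_le _ _).trans (add_le_add (hM x hx) (hM' x hx))

theorem const_mul (c : ℝ) (h : SmoothBdd n V g) : SmoothBdd n V (fun x => c * g x) := by
  refine ⟨contDiffOn_const.mul h.1, fun m hm => ?_⟩
  obtain ⟨M, hM⟩ := h.2 m hm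
  refine ⟨|c| * M, fun x hx => ?_⟩
  rw [iteratedDeriv_const_mul_field, abs_mul]
  exact mul_le_mul_of_nonneg_left (hM x hx) (abs_nonneg c)

theorem zero : SmoothBdd n V (fun _ => 0) :=
  ⟨contDiffOn_const, fun m _ => ⟨0, fun x _ => by simp⟩⟩

theorem sum (hV : IsOpen V) {ι : Type*} (S : Finset ι) {f : ι → ℝ → ℝ}
    (h : ∀ i ∈ S, SmoothBdd n V (f i)) : SmoothBdd n V (fun x => ∑ i ∈ S, f i x) := by
  classical
  induction S using Finset.induction_on with
  | empty => simpa using zero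
  | insert a S ha ih =>
    simp_rw [Finset.sum_insert ha]
    exact (h a (Finset.mem_insert_self a S)).add hV
      (ih fun i hi => h i (Finset.mem_insert_of_mem hi))

theorem sub (hV : IsOpen V) (h : SmoothBdd n V g) (h' : SmoothBdd n V g') :
    SmoothBdd n V (fun x => g x - g' x) := by
  have := h.add hV (h'.const_mul (-1))
  simpa [sub_eq_add_neg] using this

theorem congr (hV : IsOpen V) (h : SmoothBdd n V g) (he : EqOn g' g V) : SmoothBdd n V g' := by
  refine ⟨h.1.congr he, fun m hm => ?_⟩
  obtain ⟨M, hM⟩ := h.2 m hm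
  exact ⟨M, fun x hx => by rw [he.iteratedDeriv_of_isOpen hV m hx]; exact hM x hx⟩

theorem comp_sub (h : SmoothBdd n V g) {q : ℝ} (hq : ∀ x ∈ V', x - q ∈ V) :
    SmoothBdd n V' (fun x => g (x - q)) := by
  refine ⟨h.1.comp (contDiffOn_id.sub contDiffOn_const) hq, fun m hm => ?_⟩
  obtain ⟨M, hM⟩ := h.2 m hm
  refine ⟨M, fun x hx => ?_⟩
  rw [iteratedDeriv_comp_sub_const]
  exact hM _ (hq x hx)

theorem deriv (hV : IsOpen V) (h : SmoothBdd (n + 1) V g) : SmoothBdd n V (deriv g) := by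
  refine ⟨((contDiffOn_succ_iff_deriv_of_isOpen hV).1 (by exact_mod_cast h.1)).2.2, fun m hm => ?_⟩
  obtain ⟨M, hM⟩ := h.2 (m + 1) (by omega)
  refine ⟨M, fun x hx => ?_⟩
  rw [← iteratedDeriv_succ']
  exact hM x hx

theorem succ (hV : IsOpen V) (hd : ∀ x ∈ V, HasDerivAt g (g' x) x)
    (hb : ∃ M : ℝ, ∀ x ∈ V, |g x| ≤ M) (h : SmoothBdd n V g') : SmoothBdd (n + 1) V g := by
  have he : EqOn (_root_.deriv g) g' V := fun x hx => (hd x hx).deriv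
  have h1 := h.congr hV he
  refine ⟨?_, fun m hm => ?_⟩
  · have := (contDiffOn_succ_iff_deriv_of_isOpen (n := n) (f := g) hV).2
      ⟨fun x hx => (hd x hx).differentiableAt.differentiableWithinAt, by simp, h1.1⟩
    exact_mod_cast this
  · cases m with
    | zero => simpa using hb
    | succ m =>
      obtain ⟨M, hM⟩ := h1.2 m (by omega)
      refine ⟨M, fun x hx => ?_⟩
      rw [iteratedDeriv_succ']
      exact hM x hx

theorem of_continuousOn (hc : ContinuousOn g V) (hb : ∃ M : ℝ, ∀ x ∈ V, |g x| ≤ M) :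
    SmoothBdd 0 V g := by
  refine ⟨by simpa using hc, fun m hm => ?_⟩
  obtain rfl : m = 0 := by omega
  simpa using hb

end SmoothBdd

/-! ### Kernel towers and the bootstrap -/

/-- A family of kernels, each of which is a piecewise primitive of the next one, with jumps at the
points of `S`. -/
structure KernelTower (j : ℕ) (S : Finset ℝ) (J k : ℕ → ℝ → ℝ) : Prop where
  memLp : ∀ i ≤ j, MemLp (k i) 2
  integrable : ∀ i ≤ j, Integrable (k i)
  piecewise : ∀ i < j, PiecewisePrimitive S (J i) (k (i + 1)) (k i)

/-- The derivative of `k i` * w is `k (i + 1)` * w plus the terms `J i q` w(x - q). Induction on the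
order climbs the tower. Only those shifts q that carry a nonzero jump demand regularity of `w`, and
one order less than the conclusion. -/
theorem KernelTower.smoothBdd_realConv {j : ℕ} {S : Finset ℝ} {J k : ℕ → ℝ → ℝ}
    (hk : KernelTower j S J k) {w : ℝ → ℝ} (hw2 : MemLp w 2) (hw : Integrable w) {V : Set ℝ}
    (hV : IsOpen V) (n i : ℕ) (hn : i + n ≤ j)
    (h : ∀ q ∈ S, (∃ i < j, J i q ≠ 0) → ∀ m < n, SmoothBdd m V (fun x => w (x - q))) :
    SmoothBdd n V (realConv (k i) w) := by
  have hb : ∀ i ≤ j, ∃ M : ℝ, ∀ x ∈ V, |realConv (k i) w x| ≤ M := fun i hi =>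
    ⟨_, fun x _ => abs_realConv_le (hk.memLp i hi) hw2 x⟩
  induction n generalizing i with
  | zero =>
    exact SmoothBdd.of_continuousOn (continuous_realConv (hk.memLp i (by omega)) hw2).continuousOn
      (hb i (by omega))
  | succ n ih =>
    have hq : ∀ q ∈ S, SmoothBdd n V (fun x => J i q * w (x - q)) := by
      intro q hq
      by_cases h0 : J i q = 0
      · simpa [h0] using SmoothBdd.zero
      · exact (h q hq ⟨i, by omega, h0⟩ n (by omega)).const_mul _
    have h1 : SmoothBdd n V (fun x => realConv (k (i + 1)) w x + ∑ q ∈ S, J i q * w (x - q)) :=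
      (ih (i + 1) (by omega) fun q hq hj m hm => h q hq hj m (by omega)).add hV
        (SmoothBdd.sum hV S hq)
    refine SmoothBdd.succ hV (fun x hx => ?_) (hb i (by omega)) h1
    have e : realConv (k i) w =
        primitive (fun t => realConv (k (i + 1)) w t + ∑ q ∈ S, J i q * w (t - q)) := by
      ext x
      -- The roles are exchanged: `w` serves as the convolution kernel and `k i` as the piecewise
      -- primitive.
      rw [realConv_comm, (hk.piecewise i (by omega)).realConv_eq hw (hk.integrable _ (by omega))]
      simp_rw [realConv_comm w]
    rw [e]
    refine hasDerivAt_primitive ?_ ((h1.1.continuousOn).continuousAt (hV.mem_nhds hx))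
    simp_rw [← realConv_comm w]
    exact integrable_realConv_add_jumps hw (hk.integrable _ (by omega))

/-- Bootstrapping for the convolution equation `κ w = k₀ * w + R`. -/
theorem KernelTower.smoothBdd_of_equation {j : ℕ} {S : Finset ℝ} {J k : ℕ → ℝ → ℝ}
    (hk : KernelTower j S J k) {w R : ℝ → ℝ} (hw2 : MemLp w 2) (hw : Integrable w) {κ : ℝ}
    (hκ : κ ≠ 0) {V : ℕ → Set ℝ} (hV : ∀ n, IsOpen (V n))
    (heq : ∀ x ∈ V 0, κ * w x = realConv (k 0) w x + R x)
    (hR : ∀ m < j, SmoothBdd m (V 0) R) (hanti : Antitone V)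
    (hshift : ∀ q ∈ S, (∃ i < j, J i q ≠ 0) → ∀ n, ∀ x ∈ V (n + 1), x - q ∈ V n)
    (n : ℕ) (hn : n ≤ j) : SmoothBdd n (V n) (realConv (k 0) w) := by
  induction n with
  | zero => exact hk.smoothBdd_realConv hw2 hw (hV 0) 0 0 (by omega) (by simp)
  | succ n ih =>
    refine hk.smoothBdd_realConv hw2 hw (hV _) (n + 1) 0 (by omega) fun q hq hj m hm => ?_
    -- The equation transfers order n from k₀ * w to `w` on `V n`. Since n < j here, the remainder
    -- is never needed at order j, where the translates of K may fail to be bounded.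
    have h1 := ((ih (by omega)).add (hV n)
      ((hR n (by omega)).mono (hanti (Nat.zero_le n)))).const_mul κ⁻¹
    have h2 : SmoothBdd n (V n) w := by
      refine h1.congr (hV n) fun x hx => ?_
      rw [← heq x (hanti (Nat.zero_le n) hx)]
      field_simp
    exact (h2.comp_sub (hshift q hq hj n)).of_le (by omega)

/-! ### Regularity of the kernel and of its translates -/

section Kernel

variable {K : ℝ → ℝ} {δ : ℝ}

theorem KernelA1.iteratedDeriv_eq_zero (h : KernelA1 K δ) (i : ℕ) {x : ℝ} (hx : δ < |x|) :
    iteratedDeriv i K x = 0 := by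
  have ho : IsOpen {x : ℝ | δ < |x|} := isOpen_lt continuous_const continuous_abs
  have : EqOn K (fun _ => 0) {x : ℝ | δ < |x|} := fun y hy => h.support y (le_of_lt hy)
  rw [this.iteratedDeriv_of_isOpen ho i hx]
  simp

theorem KernelA1.iteratedDeriv_neg (h : KernelA1 K δ) (i : ℕ) (x : ℝ) :
    iteratedDeriv i K (-x) = (-1) ^ i * iteratedDeriv i K x := by
  have h1 := iteratedDeriv_comp_neg i K (-x)
  simp only [neg_neg, h.radial, smul_eq_mul] at h1
  exact h1

theorem KernelA1.contDiffOn (h1 : KernelA1 K δ) (h2 : KernelA2 K δ) :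
    ContDiffOn ℝ ∞ K {0, δ, -δ}ᶜ := by
  intro x hx
  simp only [mem_compl_iff, mem_insert_iff, mem_singleton_iff, not_or] at hx
  refine ContDiffAt.contDiffWithinAt ?_
  rcases lt_trichotomy |x| δ with hlt | heq | hgt
  · rw [abs_lt] at hlt
    rcases lt_or_gt_of_ne hx.1 with h0 | h0
    · exact h2.smooth_left.contDiffAt (Ioo_mem_nhds hlt.1 h0)
    · exact h2.smooth_right.contDiffAt (Ioo_mem_nhds h0 hlt.2)
  · rcases abs_choice x with h | h <;> rw [h] at heq
    · exact absurd heq hx.2.1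
    · exact absurd (by linarith) hx.2.2
  · have ho : IsOpen {x : ℝ | δ < |x|} := isOpen_lt continuous_const continuous_abs
    have : K =ᶠ[𝓝 x] fun _ => 0 := by
      filter_upwards [ho.mem_nhds hgt] with y hy using h1.support y (le_of_lt hy)
    exact contDiffAt_const.congr_of_eventuallyEq this

theorem isOpen_compl_kernel (δ : ℝ) : IsOpen ({0, δ, -δ}ᶜ : Set ℝ) :=
  (Set.toFinite _).isClosed.isOpen_compl

theorem ContDiffOn.hasDerivAt_iteratedDeriv {g : ℝ → ℝ} {V : Set ℝ} {n : ℕ} (hV : IsOpen V)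
    (h : ContDiffOn ℝ n g V) {i : ℕ} (hi : i < n) {x : ℝ} (hx : x ∈ V) :
    HasDerivAt (iteratedDeriv i g) (iteratedDeriv (i + 1) g x) x := by
  rw [iteratedDeriv_succ]
  refine DifferentiableAt.hasDerivAt ?_
  have h1 : DifferentiableOn ℝ (iteratedDerivWithin i g V) V :=
    h.differentiableOn_iteratedDerivWithin (by exact_mod_cast hi) hV.uniqueDiffOn
  exact ((h1.congr fun y hy => (iteratedDerivWithin_of_isOpen hV hy).symm).differentiableAt
    (hV.mem_nhds hx))

/-- Every derivative vanishes off [-δ, δ], a set of finite measure, so L^∞ and L² bounds pass to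
smaller exponents. -/
theorem KernelA1.memLp_iteratedDeriv (h1 : KernelA1 K δ) {j : ℕ}
    (hbdd : ∀ i < j, MemLp (iteratedDeriv i K) ⊤ volume)
    (hL2 : MemLp (iteratedDeriv j K) 2 volume) {i : ℕ} (hi : i ≤ j) {p : ENNReal} (hp : p ≤ 2) :
    MemLp (iteratedDeriv i K) p := by
  have hind : (Icc (-δ) δ).indicator (iteratedDeriv i K) = iteratedDeriv i K := by
    rw [indicator_eq_self]
    intro x hx
    by_contra hc
    refine hx (h1.iteratedDeriv_eq_zero i ?_)
    rw [mem_Icc, ← abs_le, not_le] at hc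
    exact hc
  rw [← hind, memLp_indicator_iff_restrict measurableSet_Icc]
  rcases hi.lt_or_eq with h | rfl
  · exact ((hbdd i h).restrict _).mono_exponent le_top
  · exact (hL2.restrict _).mono_exponent hp

/-- On each half-interval K^(i) is a constant plus the primitive of K^(i+1), so it has finite
one-sided limits at 0 and ±δ, and jumps only there. The same representation bounds it off these
points. -/
theorem KernelA1.piecewisePrimitive (hδ : 0 < δ) (h1 : KernelA1 K δ) (h2 : KernelA2 K δ) (i : ℕ)
    (hint : Integrable (iteratedDeriv (i + 1) K)) :
    (∃ c : ℝ → ℝ, PiecewisePrimitive {0, δ, -δ} c (iteratedDeriv (i + 1) K) (iteratedDeriv i K) ∧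
      (Tendsto (iteratedDeriv i K) (𝓝[<] δ) (𝓝 0) → c δ = 0 ∧ c (-δ) = 0)) ∧
    ∃ M : ℝ, ∀ x ∈ ({0, δ, -δ}ᶜ : Set ℝ), |iteratedDeriv i K x| ≤ M := by
  have hd : ∀ x ∈ ({0, δ, -δ}ᶜ : Set ℝ),
      HasDerivAt (iteratedDeriv i K) (iteratedDeriv (i + 1) K x) x := fun x hx =>
    ((h1.contDiffOn h2).of_le (by exact_mod_cast le_top)).hasDerivAt_iteratedDeriv
      (isOpen_compl_kernel δ) (Nat.lt_succ_self i) hx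
  have hl : Ioo (-δ) 0 ⊆ ({0, δ, -δ}ᶜ : Set ℝ) := by
    rintro x ⟨hx1, hx2⟩ (h | h | h) <;> simp_all; linarith
  have hr : Ioo 0 δ ⊆ ({0, δ, -δ}ᶜ : Set ℝ) := by
    rintro x ⟨hx1, hx2⟩ (h | h | h) <;> simp_all; linarith
  obtain ⟨C₁, hC₁⟩ := exists_eq_const_add_primitive (neg_lt_zero.2 hδ) hint
    fun x hx => hd x (hl hx)
  obtain ⟨C₂, hC₂⟩ := exists_eq_const_add_primitive hδ hint fun x hx => hd x (hr hx)
  have hcover : ∀ x ∈ ({0, δ, -δ}ᶜ : Set ℝ), x ∈ Ioo (-δ) 0 ∨ x ∈ Ioo 0 δ ∨ δ < |x| := by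
    intro x hx
    simp only [mem_compl_iff, mem_insert_iff, mem_singleton_iff, not_or] at hx
    rcases lt_or_ge δ |x| with h | h
    · exact Or.inr (Or.inr h)
    · rw [abs_le] at h
      rcases lt_or_gt_of_ne hx.1 with h0 | h0
      · exact Or.inl ⟨lt_of_le_of_ne h.1 (Ne.symm hx.2.2), h0⟩
      · exact Or.inr (Or.inl ⟨h0, lt_of_le_of_ne h.2 hx.2.1⟩)
  have hind : ∀ l : ℕ, (fun x => (Ioo (-δ) 0).indicator (iteratedDeriv l K) x +
      (Ioo 0 δ).indicator (iteratedDeriv l K) x) =ᵐ[volume] iteratedDeriv l K := by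
    intro l
    have h0 : ({0, δ, -δ}ᶜ : Set ℝ) ∈ ae volume :=
      compl_mem_ae_iff.2 ((Set.toFinite _).measure_zero volume)
    filter_upwards [h0] with x hx
    rcases hcover x hx with h | h | h
    · have h' : x ∉ Ioo 0 δ := fun h' => absurd h'.1 (not_lt.2 h.2.le)
      simp only [indicator_of_mem h, indicator_of_notMem h', add_zero]
    · have h' : x ∉ Ioo (-δ) 0 := fun h' => absurd h'.2 (not_lt.2 h.1.le)
      simp only [indicator_of_mem h, indicator_of_notMem h', zero_add]
    · rw [h1.iteratedDeriv_eq_zero l h]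
      simp [indicator_apply, h1.iteratedDeriv_eq_zero l h]
  refine ⟨⟨_, ((PiecewisePrimitive.indicator_Ioo (S := {0, δ, -δ}) hint (neg_lt_zero.2 hδ)
    (by simp) (by simp) (Eventually.of_forall hC₁)).add
      (hint.indicator measurableSet_Ioo) (hint.indicator measurableSet_Ioo)
    (PiecewisePrimitive.indicator_Ioo (S := {0, δ, -δ}) hint hδ (by simp) (by simp)
      (Eventually.of_forall hC₂))).congr (hind (i + 1)) (hind i), fun hlim => ?_⟩, ?_⟩
  · have hcont := continuous_primitive hint
    have e2 : C₂ + primitive (iteratedDeriv (i + 1) K) δ = 0 := by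
      refine tendsto_nhds_unique ?_ hlim
      refine Tendsto.congr' (f₁ := fun x => C₂ + primitive (iteratedDeriv (i + 1) K) x) ?_
        ((hcont.tendsto δ).const_add C₂ |>.mono_left nhdsWithin_le_nhds)
      filter_upwards [Ioo_mem_nhdsLT hδ] with x hx using (hC₂ x hx).symm
    -- The parity of K^(i) carries the vanishing limit from δ⁻ to (-δ)⁺, so both outer jumps vanish
    -- together.
    have hlim' : Tendsto (iteratedDeriv i K) (𝓝[>] (-δ)) (𝓝 0) := by
      have hneg : Tendsto (fun x : ℝ => -x) (𝓝[>] (-δ)) (𝓝[<] δ) := by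
        simpa using tendsto_neg_nhdsGT (a := -δ)
      have := (hlim.comp hneg).const_mul ((-1) ^ i)
      rw [mul_zero] at this
      refine this.congr fun x => ?_
      simp only [Function.comp, h1.iteratedDeriv_neg i x]
      rw [← mul_assoc, ← mul_pow]; simp
    have e1 : C₁ + primitive (iteratedDeriv (i + 1) K) (-δ) = 0 := by
      refine tendsto_nhds_unique ?_ hlim'
      refine Tendsto.congr' (f₁ := fun x => C₁ + primitive (iteratedDeriv (i + 1) K) x) ?_
        ((hcont.tendsto (-δ)).const_add C₁ |>.mono_left nhdsWithin_le_nhds)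
      filter_upwards [Ioo_mem_nhdsGT (neg_lt_zero.2 hδ)] with x hx using (hC₁ x hx).symm
    have n1 : δ ≠ -δ := by linarith
    constructor
    · simp [hδ.ne', n1, e2]
    · simp [hδ.ne', n1.symm, e1]
  · refine ⟨|C₁| + |C₂| + ∫ t, |iteratedDeriv (i + 1) K t|, fun x hx => ?_⟩
    have hp := abs_primitive_le hint x
    have hp0 := (abs_nonneg _).trans hp
    rcases hcover x hx with h | h | h
    · rw [hC₁ x h]
      have := abs_add_le C₁ (primitive (iteratedDeriv (i + 1) K) x)
      linarith [abs_nonneg C₂]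
    · rw [hC₂ x h]
      have := abs_add_le C₂ (primitive (iteratedDeriv (i + 1) K) x)
      linarith [abs_nonneg C₁]
    · rw [h1.iteratedDeriv_eq_zero i h, abs_zero]
      positivity

/-- The tower of derivatives of the kernel. -/
theorem KernelA1.exists_kernelTower (hδ : 0 < δ) (h1 : KernelA1 K δ) (h2 : KernelA2 K δ) {j : ℕ}
    (hbdd : ∀ i < j, MemLp (iteratedDeriv i K) ⊤ volume)
    (hL2 : MemLp (iteratedDeriv j K) 2 volume) :
    ∃ J : ℕ → ℝ → ℝ, KernelTower j {0, δ, -δ} J (fun i => iteratedDeriv i K) ∧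
      ∀ i < j, Tendsto (iteratedDeriv i K) (𝓝[<] δ) (𝓝 0) → J i δ = 0 ∧ J i (-δ) = 0 := by
  have hi : ∀ i ≤ j, Integrable (iteratedDeriv i K) := fun i hi =>
    memLp_one_iff_integrable.1 (h1.memLp_iteratedDeriv hbdd hL2 hi one_le_two)
  have : ∀ i, ∃ c : ℝ → ℝ, i < j →
      PiecewisePrimitive {0, δ, -δ} c (iteratedDeriv (i + 1) K) (iteratedDeriv i K) ∧
      (Tendsto (iteratedDeriv i K) (𝓝[<] δ) (𝓝 0) → c δ = 0 ∧ c (-δ) = 0) := by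
    intro i
    by_cases hij : i < j
    · obtain ⟨c, hc⟩ := (h1.piecewisePrimitive hδ h2 i (hi (i + 1) hij)).1
      exact ⟨c, fun _ => hc⟩
    · exact ⟨0, fun h => absurd h hij⟩
  choose J hJ using this
  exact ⟨J, ⟨fun i hij => h1.memLp_iteratedDeriv hbdd hL2 hij le_rfl, hi,
    fun i hij => (hJ i hij).1⟩, fun i hij => (hJ i hij).2⟩

/-- Away from `0` and `±δ` the kernel is smooth with bounded derivatives of order less than `j`. -/
theorem KernelA1.smoothBdd (hδ : 0 < δ) (h1 : KernelA1 K δ) (h2 : KernelA2 K δ) {j : ℕ}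
    (hbdd : ∀ i < j, MemLp (iteratedDeriv i K) ⊤ volume)
    (hL2 : MemLp (iteratedDeriv j K) 2 volume) {m : ℕ} (hm : m < j) :
    SmoothBdd m {0, δ, -δ}ᶜ K :=
  ⟨(h1.contDiffOn h2).of_le (by exact_mod_cast le_top), fun i hi =>
    (h1.piecewisePrimitive hδ h2 i (memLp_one_iff_integrable.1
      (h1.memLp_iteratedDeriv hbdd hL2 (by omega) one_le_two))).2⟩

/-- Translates of the kernel are regular near the origin. -/
theorem KernelA1.eventually_smoothBdd_comp_sub (hδ : 0 < δ) (h1 : KernelA1 K δ)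
    (h2 : KernelA2 K δ) {j : ℕ} {p : ℝ} (hp0 : p ≠ 0) (hp : |p| ≠ δ ∨ j = 0) :
    ∃ ε > 0, SmoothBdd j (Ioo (-ε) 0 ∪ Ioo 0 ε) (fun x => K (x - p)) := by
  have hcomp : -p ∈ ({0, δ, -δ}ᶜ : Set ℝ) →
      ∃ ε > 0, SmoothBdd j (Ioo (-ε) 0 ∪ Ioo 0 ε) (fun x => K (x - p)) := by
    intro hmem
    obtain ⟨ε, hε, hsub⟩ := Metric.isOpen_iff.1 (isOpen_compl_kernel δ) _ hmem
    have hmap : ∀ x ∈ Icc (-(ε / 2)) (ε / 2), x - p ∈ ({0, δ, -δ}ᶜ : Set ℝ) := by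
      intro x hx
      refine hsub ?_
      rw [Metric.mem_ball, Real.dist_eq, show x - p - -p = x by ring]
      exact (abs_le.2 hx).trans_lt (by linarith)
    have hcd : ContDiffOn ℝ ∞ (fun x => K (x - p)) (Ioo (-ε) ε) :=
      (h1.contDiffOn h2).comp (contDiffOn_id.sub contDiffOn_const) fun x hx => hsub (by
        rw [Metric.mem_ball, Real.dist_eq, show x - p - -p = x by ring]
        exact abs_lt.2 hx)
    have hss : Ioo (-(ε / 2)) 0 ∪ Ioo 0 (ε / 2) ⊆ Icc (-(ε / 2)) (ε / 2) := by
      rintro x (hx | hx)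
      · exact ⟨hx.1.le, by linarith [hx.2]⟩
      · exact ⟨by linarith [hx.1], hx.2.le⟩
    have hss2 : Icc (-(ε / 2)) (ε / 2) ⊆ Ioo (-ε) ε := fun x hx =>
      ⟨by linarith [hx.1], by linarith [hx.2]⟩
    -- Halving the radius places the punctured interval in a compact set on which the translate is
    -- smooth, hence its derivatives are bounded.
    refine ⟨ε / 2, by positivity, (hcd.mono (hss.trans hss2)).of_le (by exact_mod_cast le_top),
      fun m hm => ?_⟩
    have hcont : ContinuousOn (iteratedDeriv m fun x => K (x - p)) (Icc (-(ε / 2)) (ε / 2)) := by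
      intro x hx
      refine ContinuousAt.continuousWithinAt ?_
      exact ((hcd.of_le (by exact_mod_cast le_top)).hasDerivAt_iteratedDeriv isOpen_Ioo
        (Nat.lt_succ_self m) (hss2 hx)).continuousAt
    obtain ⟨M, hM⟩ := isCompact_Icc.exists_bound_of_continuousOn hcont
    exact ⟨M, fun x hx => hM x (hss hx)⟩
  by_cases hmem : |p| = δ
  -- Here 0 - p is an endpoint ±δ of the support. For j = 0 only continuity off 0 and boundedness
  -- are needed, and the finite one-sided limits of (A2) provide the bound.
  · obtain rfl : j = 0 := hp.resolve_left (not_not.2 hmem)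
    have hpc : p = δ ∨ p = -δ := by
      rcases abs_choice p with h | h <;> rw [h] at hmem
      · exact Or.inl hmem
      · exact Or.inr (by linarith)
    obtain ⟨lL, hL⟩ := h2.limit_left
    obtain ⟨lR, hR⟩ := h2.limit_right
    have bL := (hL.abs.isBoundedUnder_le).eventually_le
    have bR := (hR.abs.isBoundedUnder_le).eventually_le
    obtain ⟨ML, bL⟩ := bL
    obtain ⟨MR, bR⟩ := bR
    obtain ⟨u, hu, hu'⟩ := (mem_nhdsGT_iff_exists_Ioo_subset).1 bL
    obtain ⟨v, hv, hv'⟩ := (mem_nhdsLT_iff_exists_Ioo_subset).1 bR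
    have hu : -δ < u := hu
    have hv : v < δ := hv
    refine ⟨min δ (min (u + δ) (δ - v)), by simp [hδ]; constructor <;> linarith,
      SmoothBdd.of_continuousOn ?_ ⟨max 0 (max ML MR), ?_⟩⟩
    · refine (h1.contDiffOn h2).continuousOn.comp (by fun_prop) ?_
      rintro x hx
      simp only [mem_union, mem_Ioo, lt_min_iff, neg_lt, mem_compl_iff, mem_insert_iff,
        mem_singleton_iff, not_or] at hx ⊢
      rcases hpc with rfl | rfl <;> rcases hx with hx | hx <;>
        refine ⟨fun h => ?_, fun h => ?_, fun h => ?_⟩ <;> linarith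
    · intro x hx
      simp only [mem_union, mem_Ioo, lt_min_iff, neg_lt] at hx
      rcases hpc with rfl | rfl <;> rcases hx with hx | hx
      · rw [h1.support _ (by rw [abs_of_neg] <;> linarith)]; simp
      · exact (hu' ⟨by linarith, by linarith⟩ : |K _| ≤ ML).trans (by simp)
      · exact (hv' ⟨by linarith, by linarith⟩ : |K _| ≤ MR).trans (by simp)
      · rw [h1.support _ (by rw [abs_of_pos] <;> linarith)]; simp
  · refine hcomp ?_
    simp only [mem_compl_iff, mem_insert_iff, mem_singleton_iff, not_or]
    refine ⟨neg_ne_zero.2 hp0, fun h => hmem ?_, fun h => hmem ?_⟩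
    · rw [← abs_neg, h, abs_of_pos hδ]
    · rw [neg_inj.1 h, abs_of_pos hδ]

end Kernel

/-! ### Propagation of the singularity to order j + 1 -/

/-- A singular derivative dominates a bounded perturbation. -/
theorem singular_of_deriv_eq {K v : ℝ → ℝ} {j : ℕ} {α ε : ℝ} (hα : α ≠ 0) (hε : 0 < ε)
    (hK : ContDiffOn ℝ j K (Ioo (-ε) 0 ∪ Ioo 0 ε)) {B : ℝ → ℝ}
    (hB : SmoothBdd j (Ioo (-ε) 0 ∪ Ioo 0 ε) B)
    (hv : ∀ x ∈ Ioo (-ε) 0 ∪ Ioo 0 ε, HasDerivAt v (α * K x + B x) x)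
    (hsing : UnboundedAtZero (iteratedDeriv j K)) :
    ContDiffOffZero (j + 1) v ∧ UnboundedAtZero (iteratedDeriv (j + 1) v) ∧
      (InfiniteAtZero (iteratedDeriv j K) → InfiniteAtZero (iteratedDeriv (j + 1) v)) := by
  set V := Ioo (-ε) 0 ∪ Ioo 0 ε with hVdef
  have hV : IsOpen V := isOpen_Ioo.union isOpen_Ioo
  have hcd : ContDiffOn ℝ (j + 1 : ℕ) v V := by
    have := (contDiffOn_succ_iff_deriv_of_isOpen (n := j) (f := v) hV).2
      ⟨fun x hx => (hv x hx).differentiableAt.differentiableWithinAt, by simp,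
        ((contDiffOn_const.mul hK).add hB.1).congr fun x hx => (hv x hx).deriv⟩
    exact_mod_cast this
  have hform : ∀ x ∈ V, iteratedDeriv (j + 1) v x = α * iteratedDeriv j K x
      + iteratedDeriv j B x := by
    intro x hx
    have he : EqOn (deriv v) (fun x => α * K x + B x) V := fun x hx => (hv x hx).deriv
    rw [iteratedDeriv_succ', he.iteratedDeriv_of_isOpen hV j hx, iteratedDeriv_fun_add
      (contDiffAt_const.mul (hK.contDiffAt (hV.mem_nhds hx))) (hB.1.contDiffAt (hV.mem_nhds hx)),
      iteratedDeriv_const_mul_field]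
  obtain ⟨M, hM⟩ := hB.2 j le_rfl
  have hlow : ∀ x ∈ V, |α| * |iteratedDeriv j K x| - M ≤ |iteratedDeriv (j + 1) v x| := by
    intro x hx
    rw [hform x hx, ← abs_mul]
    have h1 := abs_sub_abs_le_abs_sub (α * iteratedDeriv j K x) (-iteratedDeriv j B x)
    rw [abs_neg, sub_neg_eq_add] at h1
    linarith [hM x hx]
  have hl : V ∈ 𝓝[<] (0 : ℝ) := mem_of_superset (Ioo_mem_nhdsLT (neg_lt_zero.2 hε))
    subset_union_left
  have hr : V ∈ 𝓝[>] (0 : ℝ) := mem_of_superset (Ioo_mem_nhdsGT hε) subset_union_right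
  have hα' := abs_pos.2 hα
  have hunb : ∀ l : Filter ℝ, V ∈ l → (∀ M : ℝ, ∃ᶠ x in l, M < |iteratedDeriv j K x|) →
      ∀ M : ℝ, ∃ᶠ x in l, M < |iteratedDeriv (j + 1) v x| := by
    intro l hVl h L
    refine ((h ((L + M) / |α|)).and_eventually hVl).mono fun x hx => ?_
    have := (div_lt_iff₀' hα').1 hx.1
    linarith [hlow x hx.2]
  have hinf : ∀ l : Filter ℝ, V ∈ l → Tendsto (fun x => |iteratedDeriv j K x|) l atTop →
      Tendsto (fun x => |iteratedDeriv (j + 1) v x|) l atTop := by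
    intro l hVl h
    refine tendsto_atTop_mono' l ?_
      (tendsto_atTop_add_const_right l (-M) (h.const_mul_atTop hα'))
    filter_upwards [hVl] with x hx
    linarith [hlow x hx]
  exact ⟨⟨ε, hε, hcd.mono subset_union_left, hcd.mono subset_union_right⟩,
    ⟨hunb _ hl hsing.1, hunb _ hr hsing.2⟩, fun h => ⟨hinf _ hl h.1, hinf _ hr h.2⟩⟩

/-! ### Weak derivatives in one dimension -/

theorem integral_primitive_mul_deriv {w φ : ℝ → ℝ} (hw : Integrable w) (hφ : ContDiff ℝ ∞ φ)
    (hc : HasCompactSupport φ) : ∫ x, primitive w x * deriv φ x = -∫ x, w x * φ x := by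
  have hφ1 : ContDiff ℝ 1 φ := hφ.of_le (by exact_mod_cast le_top)
  have hd : Integrable (deriv φ) :=
    (hφ1.continuous_deriv le_rfl).integrable_of_hasCompactSupport hc.deriv
  have hi : Integrable (fun z : ℝ × ℝ => (if z.2 ≤ z.1 then 1 else 0) * (deriv φ z.1 * w z.2))
      (volume.prod volume) := by
    refine (hd.mul_prod hw).bdd_mul (c := 1) ?_ (Eventually.of_forall fun z => ?_)
    · exact (Measurable.ite (measurableSet_le measurable_snd measurable_fst) measurable_const
        measurable_const).aestronglyMeasurable
    · split_ifs <;> simp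
  calc ∫ x, primitive w x * deriv φ x
      = ∫ x, ∫ t, (if t ≤ x then 1 else 0) * (deriv φ x * w t) := by
        congr 1; ext x
        rw [primitive, ← integral_indicator measurableSet_Iic, ← integral_mul_const]
        congr 1; ext t
        by_cases h : t ≤ x <;> simp [h, mul_comm]
    _ = ∫ t, ∫ x, (if t ≤ x then 1 else 0) * (deriv φ x * w t) := integral_integral_swap hi
    _ = ∫ t, -(w t * φ t) := by
        congr 1; ext t
        rw [← mul_neg, ← hc.integral_Ioi_deriv_eq hφ1 t, ← integral_Ici_eq_integral_Ioi,
          ← integral_indicator measurableSet_Ici, ← integral_const_mul]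
        congr 1; ext x
        by_cases h : t ≤ x <;> simp [h, mul_comm]
    _ = _ := integral_neg _

/-- The du Bois-Reymond lemma on an interval. -/
theorem exists_ae_eq_const_of_integral_mul_deriv_eq_zero {d : ℝ → ℝ} {p q : ℝ} (hpq : p < q)
    (hd : LocallyIntegrableOn d (Ioo p q))
    (h : ∀ φ : ℝ → ℝ, ContDiff ℝ ∞ φ → HasCompactSupport φ → tsupport φ ⊆ Ioo p q →
      ∫ x, d x * deriv φ x = 0) : ∃ C, ∀ᵐ x, x ∈ Ioo p q → d x = C := by
  have hint : ∀ φ : ℝ → ℝ, Continuous φ → HasCompactSupport φ → tsupport φ ⊆ Ioo p q →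
      Integrable (fun x => d x * φ x) := by
    intro φ hφ hc hs
    have h1 : IntegrableOn d (tsupport φ) := hd.integrableOn_compact_subset hs hc
    obtain ⟨M, hM⟩ := hc.exists_bound_of_continuous hφ
    have h2 : IntegrableOn (fun x => d x * φ x) (tsupport φ) :=
      h1.mul_bdd (c := M) hφ.aestronglyMeasurable (Eventually.of_forall hM)
    refine (integrableOn_iff_integrable_of_support_subset ?_).1 h2
    intro x hx
    exact subset_tsupport φ (right_ne_zero_of_mul hx)
  let m := (p + q) / 2
  let η₀ : ContDiffBump m := ⟨(q - p) / 8, (q - p) / 4, by linarith, by linarith⟩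
  set η : ℝ → ℝ := η₀.normed volume with hη
  have hηs : tsupport η = Metric.closedBall m ((q - p) / 4) := η₀.tsupport_normed_eq
  have hηI : tsupport η ⊆ Ioo p q := by
    rw [hηs, Real.closedBall_eq_Icc]
    intro x hx
    simp only [mem_Icc, m] at hx
    exact ⟨by linarith [hx.1], by linarith [hx.2]⟩
  have hηc : HasCompactSupport η := η₀.hasCompactSupport_normed
  have hηd : ContDiff ℝ ∞ η := η₀.contDiff_normed
  have hη1 : ∫ x, η x = 1 := η₀.integral_normed
  refine ⟨∫ x, d x * η x, ?_⟩
  set D := ∫ x, d x * η x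
  have hae : ∀ᵐ x, x ∈ Ioo p q → d x - D = 0 := by
    refine isOpen_Ioo.ae_eq_zero_of_integral_contDiff_smul_eq_zero
      (hd.sub (locallyIntegrableOn_const D)) fun φ hφ hc hs => ?_
    set c := ∫ x, φ x with hcdef
    -- Subtracting c times a bump of mass one makes the integral zero. The primitive of ψ is then
    -- compactly supported in (p, q), hence an admissible test function with derivative ψ.
    set ψ : ℝ → ℝ := fun x => φ x - c * η x with hψ
    have hφi := hφ.continuous.integrable_of_hasCompactSupport hc (μ := volume)
    have hηi := hηd.continuous.integrable_of_hasCompactSupport hηc (μ := volume)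
    have hψd : ContDiff ℝ ∞ ψ := hφ.sub (contDiff_const.mul hηd)
    have hψi : Integrable ψ := hφi.sub (hηi.const_mul c)
    have hψ0 : ∫ x, ψ x = 0 := by
      rw [integral_sub hφi (hηi.const_mul c), integral_const_mul, hη1, ← hcdef]; ring
    have hKc : IsCompact (tsupport φ ∪ tsupport η) := IsCompact.union hc hηc
    have hKn : (tsupport φ ∪ tsupport η).Nonempty :=
      ⟨m, Or.inr (by rw [hηs]; exact Metric.mem_closedBall_self (by linarith))⟩
    obtain ⟨p', hp', hpl⟩ := hKc.exists_isLeast hKn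
    obtain ⟨q', hq', hql⟩ := hKc.exists_isGreatest hKn
    have hKI : tsupport φ ∪ tsupport η ⊆ Ioo p q := union_subset hs hηI
    have hψz : ∀ x, x ∉ Icc p' q' → ψ x = 0 := by
      intro x hx
      have hx' : x ∉ tsupport φ ∪ tsupport η := fun hx' => hx ⟨hpl hx', hql hx'⟩
      simp only [mem_union, not_or] at hx'
      simp [hψ, image_eq_zero_of_notMem_tsupport hx'.1, image_eq_zero_of_notMem_tsupport hx'.2]
    have hΦd : ∀ x, HasDerivAt (primitive ψ) (ψ x) x := fun x =>
      hasDerivAt_primitive hψi hψd.continuous.continuousAt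
    have hΦderiv : deriv (primitive ψ) = ψ := funext fun x => (hΦd x).deriv
    have hΦ : ContDiff ℝ ∞ (primitive ψ) := by
      rw [contDiff_infty_iff_deriv, hΦderiv]
      exact ⟨fun x => (hΦd x).differentiableAt, hψd⟩
    have hΦz : ∀ x, x ∉ Icc p' q' → primitive ψ x = 0 := by
      intro x hx
      rw [mem_Icc, not_and_or, not_le, not_le] at hx
      rcases hx with hx | hx
      · refine setIntegral_eq_zero_of_forall_eq_zero fun t ht => hψz t fun h => ?_
        have : t ≤ x := ht
        linarith [h.1]
      · rw [← hψ0]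
        refine setIntegral_eq_integral_of_forall_compl_eq_zero fun t ht => hψz t fun h => ?_
        have : x < t := not_le.1 ht
        linarith [h.2]
    have hΦs : tsupport (primitive ψ) ⊆ Icc p' q' :=
      closure_minimal (fun x hx => by by_contra hc; exact hx (hΦz x hc)) isClosed_Icc
    have hsub : Icc p' q' ⊆ Ioo p q := fun x hx =>
      ⟨(hKI hp').1.trans_le hx.1, hx.2.trans_lt (hKI hq').2⟩
    have h0 := h _ hΦ (isCompact_Icc.of_isClosed_subset (isClosed_tsupport _) hΦs)
      (hΦs.trans hsub)
    rw [hΦderiv] at h0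
    have i1 := hint φ hφ.continuous hc hs
    have i2 := hint η hηd.continuous hηc hηI
    have e1 : ∫ x, d x * ψ x = (∫ x, d x * φ x) - c * D := by
      rw [← integral_const_mul, ← integral_sub i1 (i2.const_mul c)]
      congr 1; ext x; simp only [hψ]; ring
    have e2 : ∫ x, φ x • (d x - D) = (∫ x, d x * φ x) - c * D := by
      rw [hcdef, ← integral_mul_const, ← integral_sub i1 (hφi.mul_const D)]
      congr 1; ext x; simp only [smul_eq_mul]; ring
    rw [e2, ← e1, h0]
  filter_upwards [hae] with x hx hxI
  linarith [hx hxI]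

/-- A Sobolev function on the line is a.e. a primitive of its weak derivative. -/
theorem exists_ae_eq_const_add_primitive_of_weakDeriv {U : Set ℝ} {b b' : ℝ → ℝ} {p q : ℝ}
    (hpq : p < q) (hU : Ioo p q ⊆ U) (hb : MemLp b 2 (volume.restrict U))
    (hb' : MemLp b' 2 (volume.restrict U))
    (h : ∀ φ : ℝ → ℝ, ContDiff ℝ ∞ φ → HasCompactSupport φ → tsupport φ ⊆ U →
      ∫ x in U, b x * deriv φ x = -∫ x in U, b' x * φ x) :
    Integrable ((Ioo p q).indicator b') ∧
    ∃ C, ∀ᵐ x, x ∈ Ioo p q → b x = C + primitive ((Ioo p q).indicator b') x := by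
  have hIle : ∀ {g : ℝ → ℝ}, MemLp g 2 (volume.restrict U) → IntegrableOn g (Ioo p q) :=
    fun hg => (hg.mono_measure (Measure.restrict_mono_set volume hU)).integrable
      (by norm_num)
  set w := (Ioo p q).indicator b' with hw
  have hwi : Integrable w := (integrable_indicator_iff measurableSet_Ioo).2 (hIle hb')
  refine ⟨hwi, ?_⟩
  obtain ⟨C, hC⟩ := exists_ae_eq_const_of_integral_mul_deriv_eq_zero
    (d := fun x => b x - primitive w x) hpq
    ((hIle hb).locallyIntegrableOn.sub
      ((continuous_primitive hwi).locallyIntegrable.locallyIntegrableOn _)) (by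
    intro φ hφ hc hs
    have hzero : ∀ x, x ∉ Ioo p q → φ x = 0 := fun x hx =>
      image_eq_zero_of_notMem_tsupport fun h' => hx (hs h')
    have hdzero : ∀ x, x ∉ Ioo p q → deriv φ x = 0 := fun x hx =>
      image_eq_zero_of_notMem_tsupport fun h' => hx (hs (tsupport_deriv_subset h'))
    have hφ1 : ContDiff ℝ 1 φ := hφ.of_le (by exact_mod_cast le_top)
    have hdc := hφ1.continuous_deriv le_rfl
    have h1 := h φ hφ hc (hs.trans hU)
    rw [setIntegral_eq_integral_of_forall_compl_eq_zero
        (fun x hx => by rw [hdzero x fun h' => hx (hU h'), mul_zero]),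
      setIntegral_eq_integral_of_forall_compl_eq_zero
        (fun x hx => by rw [hzero x fun h' => hx (hU h'), mul_zero])] at h1
    have h2 := integral_primitive_mul_deriv hwi hφ hc
    have h3 : ∫ x, w x * φ x = ∫ x, b' x * φ x := by
      congr 1; ext x
      by_cases hx : x ∈ Ioo p q
      · rw [hw, indicator_of_mem hx]
      · rw [hzero x hx, mul_zero, mul_zero]
    obtain ⟨M, hM⟩ := hc.deriv.exists_bound_of_continuous hdc
    have i1 : Integrable (fun x => b x * deriv φ x) := by
      have : IntegrableOn (fun x => b x * deriv φ x) (Ioo p q) :=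
        (hIle hb).mul_bdd (c := M) hdc.aestronglyMeasurable (Eventually.of_forall hM)
      refine (integrableOn_iff_integrable_of_support_subset fun x hx => ?_).1 this
      by_contra hx'
      exact hx (by simp [hdzero x hx'])
    have i2 : Integrable (fun x => primitive w x * deriv φ x) :=
      ((continuous_primitive hwi).mul hdc).integrable_of_hasCompactSupport hc.deriv.mul_left
    simp_rw [sub_mul]
    rw [integral_sub i1 i2, h1, h2, h3, sub_self])
  exact ⟨C, hC.mono fun x hx hxI => by linarith [hx hxI]⟩

/-! ### L¹ difference quotients and the L² derivative of K * U -/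

namespace KernelA1

variable {K : ℝ → ℝ} {δ : ℝ}

theorem integrable_mul_of_bound (h : KernelA1 K δ) {φ : ℝ → ℝ} (hφ : Continuous φ) :
    Integrable (fun t => K t * φ t) := by
  obtain ⟨M, hM⟩ := (isCompact_Icc (a := -δ) (b := δ)).exists_bound_of_continuousOn
    hφ.continuousOn
  have h1 : IntegrableOn (fun t => K t * φ t) (Icc (-δ) δ) := by
    refine h.integrable.integrableOn.mul_bdd (c := M) hφ.aestronglyMeasurable ?_
    filter_upwards [ae_restrict_mem measurableSet_Icc] with x hx using hM x hx
  refine (integrableOn_iff_integrable_of_support_subset fun x hx => ?_).1 h1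
  by_contra hx'
  rw [mem_Icc, ← abs_le, not_le] at hx'
  exact hx (by simp [h.support x hx'.le])

theorem integral_mul_id (h : KernelA1 K δ) : ∫ t, K t * t = 0 := by
  have h1 := integral_neg_eq_self (fun t => K t * t) volume
  simp only [h.radial, mul_neg] at h1
  rw [integral_neg] at h1
  linarith

/-- This moment is the strict gain in the parabolic test: the nonlocal operator applied to C - x² is
the constant -∫ K t². -/
theorem secondMoment_pos (h : KernelA1 K δ) (hκ : 0 < ∫ t, K t) : 0 < ∫ t, K t * t ^ 2 := by
  have hnn : 0 ≤ fun t => K t * t ^ 2 := fun t => mul_nonneg (h.nonneg t) (sq_nonneg t)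
  have hi := h.integrable_mul_of_bound (φ := fun t => t ^ 2) (by fun_prop)
  refine lt_of_le_of_ne (integral_nonneg hnn) fun h0 => ?_
  have h1 := (integral_eq_zero_iff_of_nonneg hnn hi).1 h0.symm
  have h2 : K =ᵐ[volume] fun _ => 0 := by
    filter_upwards [h1, compl_mem_ae_iff.2 (measure_singleton (μ := volume) (0 : ℝ))] with t ht ht0
    have ht0 : t ≠ 0 := ht0
    simpa [ht0] using ht
  rw [integral_congr_ae h2, integral_zero] at hκ
  exact lt_irrefl _ hκ

/-- A priori `L¹` bound from a parabolic weight. -/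
theorem exists_integral_abs_le (h : KernelA1 K δ) (hδ : 0 < δ) (hκ : 0 < ∫ t, K t) {R : ℝ}
    (hR : 0 < R) : ∃ A : ℝ, 0 ≤ A ∧ ∀ w G : ℝ → ℝ, Integrable w → Integrable G → (∀ x, 0 ≤ G x) →
      (∀ x, x ∉ Icc (-R) R → w x = 0) →
      (∀ᵐ x, (∫ t, K t) * |w x| ≤ realConv K (fun y => |w y|) x + G x) →
      ∫ x, |w x| ≤ A * ∫ x, G x := by
  set κ := ∫ t, K t with hκdef
  set m := ∫ t, K t * t ^ 2 with hm
  have hmpos : 0 < m := h.secondMoment_pos hκ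
  -- This keeps C - x² nonnegative on [-R - δ, R + δ], the reach of the kernel from [-R, R];
  -- truncating it to [-R, R] then only lowers its convolution with K.
  set C := (R + δ) ^ 2 with hC
  have hCpos : 0 < C := by positivity
  refine ⟨C / m, by positivity, fun w G hw hG hG0 hwR hineq => ?_⟩
  set ψ : ℝ → ℝ := (Icc (-R) R).indicator fun x => C - x ^ 2 with hψ
  have hsq : ∀ x ∈ Icc (-(R + δ)) (R + δ), 0 ≤ C - x ^ 2 := by
    intro x hx
    have := sq_le_sq' hx.1 hx.2
    linarith
  have hψ0 : ∀ x, 0 ≤ ψ x := fun x => indicator_nonneg (fun x hx =>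
    hsq x ⟨by linarith [hx.1], by linarith [hx.2]⟩) x
  have hψC : ∀ x, |ψ x| ≤ C := by
    intro x
    rw [abs_of_nonneg (hψ0 x)]
    by_cases hx : x ∈ Icc (-R) R
    · rw [hψ, indicator_of_mem hx]; linarith [sq_nonneg x]
    · rw [hψ, indicator_of_notMem hx]; exact hCpos.le
  have hψm : AEStronglyMeasurable ψ :=
    (Measurable.indicator (by fun_prop) measurableSet_Icc).aestronglyMeasurable
  have hconv : ∀ y ∈ Icc (-R) R, realConv K ψ y ≤ κ * (C - y ^ 2) - m := by
    intro y hy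
    have i0 := h.integrable_mul_of_bound (φ := fun t => C - (y - t) ^ 2) (by fun_prop)
    have i1 := h.integrable_mul_of_bound (φ := fun t => t) (by fun_prop)
    have i2 := h.integrable_mul_of_bound (φ := fun t => t ^ 2) (by fun_prop)
    have e : ∫ t, K t * (C - (y - t) ^ 2) = κ * (C - y ^ 2) - m := by
      have : (fun t => K t * (C - (y - t) ^ 2)) =
          fun t => K t * (C - y ^ 2) + (2 * y) * (K t * t) - K t * t ^ 2 := by
        ext t; ring
      have i3 : Integrable (fun t => K t * (C - y ^ 2) + (2 * y) * (K t * t)) :=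
        (h.integrable.mul_const _).add (i1.const_mul _)
      rw [this, integral_sub i3 i2, integral_add (h.integrable.mul_const _) (i1.const_mul _), integral_mul_const,
        integral_const_mul, h.integral_mul_id]
      ring
    rw [← e]
    refine integral_mono_of_nonneg (Eventually.of_forall fun t =>
      mul_nonneg (h.nonneg t) (hψ0 _)) i0 (Eventually.of_forall fun t => ?_)
    simp only
    rcases le_or_gt δ |t| with ht | ht
    · simp [h.support t ht]
    · refine mul_le_mul_of_nonneg_left ?_ (h.nonneg t)
      rw [abs_lt] at ht
      have := hsq (y - t) ⟨by linarith [hy.1], by linarith [hy.2]⟩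
      rw [hψ]
      exact indicator_le' (fun _ _ => le_rfl) (fun _ _ => this) _
  have hwa := hw.abs
  have b1 : Integrable (fun x => ψ x * (κ * |w x|)) :=
    (hwa.const_mul κ).bdd_mul (c := C) hψm (Eventually.of_forall hψC)
  have b2 : Integrable (fun x => ψ x * realConv K (fun y => |w y|) x) :=
    (integrable_realConv h.integrable hwa).bdd_mul (c := C) hψm (Eventually.of_forall hψC)
  have b3 : Integrable (fun x => ψ x * G x) :=
    hG.bdd_mul (c := C) hψm (Eventually.of_forall hψC)
  have s1 : ∫ x, ψ x * (κ * |w x|) ≤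
      (∫ x, ψ x * realConv K (fun y => |w y|) x) + ∫ x, ψ x * G x := by
    rw [← integral_add b2 b3]
    refine integral_mono_ae b1 (b2.add b3) ?_
    filter_upwards [hineq] with x hx
    have := mul_le_mul_of_nonneg_left hx (hψ0 x)
    simpa [mul_add] using this
  have s2 : ∫ x, ψ x * G x ≤ C * ∫ x, G x := by
    rw [← integral_const_mul]
    exact integral_mono b3 (hG.const_mul C) fun x =>
      mul_le_mul_of_nonneg_right ((le_abs_self _).trans (hψC x)) (hG0 x)
  -- By symmetry K moves onto the weight, where the parabola gains -m on [-R, R]; off that interval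
  -- w vanishes.
  have s3 : ∫ x, ψ x * realConv K (fun y => |w y|) x ≤
      (∫ x, ψ x * (κ * |w x|)) - m * ∫ x, |w x| := by
    rw [integral_mul_realConv_symm h.integrable hwa h.radial hψm hψC, ← integral_const_mul,
      ← integral_sub b1 (hwa.const_mul m)]
    have b4 : Integrable (fun y => |w y| * realConv K ψ y) := by
      refine hwa.mul_bdd (c := κ * C) ?_ (Eventually.of_forall fun y => ?_)
      · have : Integrable ψ := (integrable_indicator_iff measurableSet_Icc).2
          ((by fun_prop : Continuous fun x : ℝ => C - x ^ 2).integrableOn_Icc)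
        exact (integrable_realConv h.integrable this).1
      · refine (norm_integral_le_integral_norm _).trans ?_
        rw [hκdef, ← integral_mul_const]
        refine integral_mono_of_nonneg (Eventually.of_forall fun t => norm_nonneg _)
          (h.integrable.mul_const C) (Eventually.of_forall fun t => ?_)
        simp only [norm_mul, Real.norm_eq_abs, abs_of_nonneg (h.nonneg t)]
        exact mul_le_mul_of_nonneg_left (hψC _) (h.nonneg t)
    refine integral_mono b4 (b1.sub (hwa.const_mul m)) fun y => ?_
    simp only
    by_cases hy : y ∈ Icc (-R) R
    · have := mul_le_mul_of_nonneg_left (hconv y hy) (abs_nonneg (w y))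
      rw [hψ, indicator_of_mem hy]
      rw [hψ] at this
      linarith
    · simp [hwR y hy]
  have : m * ∫ x, |w x| ≤ C * ∫ x, G x := by linarith
  rw [div_mul_eq_mul_div, le_div_iff₀ hmpos]
  linarith

end KernelA1

/-- Uniform `L¹` difference quotients of a solution of the nonlocal equation. -/
theorem KernelA1.exists_integral_abs_diff_le {K : ℝ → ℝ} {δ : ℝ} (h : KernelA1 K δ) (hδ : 0 < δ)
    (hκ : 0 < ∫ t, K t) (hK2 : MemLp K 2) {a₁ a₂ : ℝ} (ha : a₁ < a₂) {S S' : Finset ℝ}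
    {c c' wo wf Ui Uo fe : ℝ → ℝ} (hwo : Integrable wo) (hwf : Integrable wf)
    (hUo : PiecewisePrimitive S c wo Uo) (hfe : PiecewisePrimitive S' c' wf fe)
    (hUi1 : Integrable Ui) (hUi2 : MemLp Ui 2) (hUo2 : MemLp Uo 2)
    (hsupp : ∀ x, x ∉ Ioo a₁ a₂ → Ui x = 0)
    (heq : ∀ᵐ x, (∫ t, K t) * Ui x =
      (Ioo a₁ a₂).indicator (realConv K fun y => Ui y + Uo y) x - fe x) :
    ∃ A : ℝ, ∀ η ∈ Ioo (0 : ℝ) 1,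
      ∫ x, |(Ui (x + η) + Uo (x + η)) - (Ui x + Uo x)| ≤ A * η := by
  set κ := ∫ t, K t with hκdef
  set F := realConv K fun y => Ui y + Uo y with hF
  set M := normL2 K * normL2 (fun y => Ui y + Uo y) with hM
  have hFM : ∀ x, |F x| ≤ M := abs_realConv_le hK2 (hUi2.add hUo2)
  set χ : ℝ → ℝ := (Ioo a₁ a₂).indicator fun _ => 1 with hχ
  have hχP : ∃ c₁, PiecewisePrimitive {a₁, a₂} c₁ ((Ioo a₁ a₂).indicator fun _ => 0) χ :=
    ⟨_, PiecewisePrimitive.indicator_Ioo (S := {a₁, a₂}) (w := fun _ => 0) (C := 1)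
      (integrable_zero _ _ _) ha (by simp) (by simp)
      (Eventually.of_forall fun x _ => by simp [primitive])⟩
  obtain ⟨c₁, hχP⟩ := hχP
  -- The extra 1 absorbs the translation by η < 1, so that the increment of `Ui` is still supported
  -- in [-R, R].
  obtain ⟨A, hA0, hA⟩ := h.exists_integral_abs_le hδ hκ (R := |a₁| + |a₂| + 1) (by positivity)
  set Bo := (∫ x, |wo x|) + ∑ p ∈ S, |c p|
  set Bf := (∫ x, |wf x|) + ∑ p ∈ S', |c' p|
  set Bχ := (∫ x : ℝ, |(Ioo a₁ a₂).indicator (fun _ => (0 : ℝ)) x|)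
    + ∑ p ∈ ({a₁, a₂} : Finset ℝ), |c₁ p|
  refine ⟨A * (κ * Bo + M * Bχ + Bf) + Bo, fun η hη => ?_⟩
  obtain ⟨io, bo⟩ := hUo.integral_abs_sub_le hwo hη.1
  obtain ⟨if', bf⟩ := hfe.integral_abs_sub_le hwf hη.1
  obtain ⟨iχ, bχ⟩ := hχP.integral_abs_sub_le
    (by simp) hη.1
  have hUi2' : MemLp (fun x => Ui (x + η)) 2 :=
    hUi2.comp_measurePreserving (measurePreserving_add_right volume η)
  have hUo2' : MemLp (fun x => Uo (x + η)) 2 :=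
    hUo2.comp_measurePreserving (measurePreserving_add_right volume η)
  set dUo : ℝ → ℝ := fun x => Uo (x + η) - Uo x
  set dUi : ℝ → ℝ := fun x => Ui (x + η) - Ui x with hdUi
  have ii : Integrable dUi := (hUi1.comp_add_right η).sub hUi1
  have iG1 := (integrable_realConv h.integrable io).abs
  set G : ℝ → ℝ := fun x => |realConv K dUo x| + M * |χ (x + η) - χ x| + |fe (x + η) - fe x|
    with hG
  have iG : Integrable G := (iG1.add (iχ.abs.const_mul M)).add if'.abs
  have hM0 : 0 ≤ M := (abs_nonneg _).trans (hFM 0)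
  have hGint : ∫ x, G x ≤ (κ * Bo + M * Bχ + Bf) * η := by
    have e : ∫ x, G x = (∫ x, |realConv K dUo x|) + M * (∫ x, |χ (x + η) - χ x|) +
        ∫ x, |fe (x + η) - fe x| := by
      have iG2 : Integrable (fun x => |realConv K dUo x| + M * |χ (x + η) - χ x|) :=
        iG1.add (iχ.abs.const_mul M)
      simp only [hG]
      rw [integral_add iG2 if'.abs, integral_add iG1 (iχ.abs.const_mul M), integral_const_mul]
    have e1 := integral_abs_realConv_le h.integrable io
    have e2 : ∫ x, |K x| = κ := by simp_rw [abs_of_nonneg (h.nonneg _)]; rfl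
    rw [e2] at e1
    have e3 := mul_le_mul_of_nonneg_left bo hκ.le
    have e4 := mul_le_mul_of_nonneg_left bχ hM0
    rw [e]
    linarith
  have heq' : ∀ᵐ x, κ * Ui (x + η) = (Ioo a₁ a₂).indicator F (x + η) - fe (x + η) :=
    (measurePreserving_add_right volume η).quasiMeasurePreserving.ae heq
  have hineq : ∀ᵐ x, κ * |dUi x| ≤ realConv K (fun y => |dUi y|) x + G x := by
    filter_upwards [heq, heq'] with x h1 h2
    have hind : ∀ y, (Ioo a₁ a₂).indicator F y = χ y * F y := by
      intro y
      by_cases hy : y ∈ Ioo a₁ a₂ <;> simp [hχ, hy]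
    rw [hind] at h1 h2
    have hdF : F (x + η) - F x = realConv K dUi x + realConv K dUo x := by
      have d1 : MemLp dUi 2 := hUi2'.sub hUi2
      have d2 : MemLp dUo 2 := hUo2'.sub hUo2
      have d3 : MemLp (fun y => Ui (y + η) + Uo (y + η)) 2 := hUi2'.add hUo2'
      have d4 : MemLp (fun y => Ui y + Uo y) 2 := hUi2.add hUo2
      rw [← realConv_add_right hK2 d1 d2, hF, ← realConv_comp_add,
        ← realConv_sub_right hK2 d3 d4]
      congr 1; ext y; simp only [hdUi, dUo]; ring
    -- Discrete product rule for χ F. The increments of χ, of `Uo` and of `fe` are O(η) in L¹, since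
    -- these are piecewise primitives, and go into G; only K * `dUi` has to be absorbed.
    have hk : κ * dUi x = χ x * (realConv K dUi x + realConv K dUo x)
        + (χ (x + η) - χ x) * F (x + η) - (fe (x + η) - fe x) := by
      rw [← hdF]; simp only [hdUi]; rw [mul_sub, h1, h2]; ring
    have hχ1 : |χ x| ≤ 1 := by
      by_cases hx : x ∈ Ioo a₁ a₂ <;> simp [hχ, hx]
    have hab : |realConv K dUi x| ≤ realConv K (fun y => |dUi y|) x := by
      refine (abs_realConv_le_realConv_abs K dUi x).trans (le_of_eq ?_)
      unfold realConv
      simp_rw [abs_of_nonneg (h.nonneg _)]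
    calc κ * |dUi x| = |κ * dUi x| := by rw [abs_mul, abs_of_pos hκ]
      _ ≤ |χ x| * |realConv K dUi x + realConv K dUo x| + |χ (x + η) - χ x| * |F (x + η)|
          + |fe (x + η) - fe x| := by
        rw [hk, ← abs_mul, ← abs_mul]
        exact (abs_sub _ _).trans (add_le_add (abs_add_le _ _) le_rfl)
      _ ≤ 1 * (|realConv K dUi x| + |realConv K dUo x|) + |χ (x + η) - χ x| * M
          + |fe (x + η) - fe x| := by
        gcongr
        · exact abs_add_le _ _
        · exact hFM _
      _ ≤ _ := by simp only [hG]; linarith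
  have hmain := hA dUi G ii iG (fun x => by positivity) (fun x hx => by
    have hx1 : x ∉ Ioo a₁ a₂ := fun hx' => hx
      ⟨by linarith [hx'.1, neg_abs_le a₁, abs_nonneg a₂],
        by linarith [hx'.2, le_abs_self a₂, abs_nonneg a₁]⟩
    have hx2 : x + η ∉ Ioo a₁ a₂ := fun hx' => hx
      ⟨by linarith [hx'.1, neg_abs_le a₁, abs_nonneg a₂, hη.2],
        by linarith [hx'.2, le_abs_self a₂, abs_nonneg a₁, hη.1]⟩
    simp [hdUi, hsupp _ hx1, hsupp _ hx2]) hineq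
  calc ∫ x, |(Ui (x + η) + Uo (x + η)) - (Ui x + Uo x)|
      ≤ ∫ x, (|dUi x| + |dUo x|) := by
        refine integral_mono_of_nonneg (Eventually.of_forall fun x => abs_nonneg _)
          (ii.abs.add io.abs) (Eventually.of_forall fun x => ?_)
        simp only
        rw [show (Ui (x + η) + Uo (x + η)) - (Ui x + Uo x) = dUi x + dUo x by
          simp only [hdUi, dUo]; ring]
        exact abs_add_le _ _
    _ = (∫ x, |dUi x|) + ∫ x, |dUo x| := integral_add ii.abs io.abs
    _ ≤ _ := by
        have := mul_le_mul_of_nonneg_left hGint hA0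
        linarith

/-- A convolution with bounded `L¹` difference quotients has a square integrable derivative. -/
theorem exists_memLp_integral_eq_of_diff_le {K U : ℝ → ℝ} (hK : Integrable K) (hK2 : MemLp K 2)
    (heven : ∀ x, K (-x) = K x) (hU : Integrable U) (hU2 : MemLp U 2) {A : ℝ}
    (hA : ∀ η ∈ Ioo (0 : ℝ) 1, ∫ x, |U (x + η) - U x| ≤ A * η) :
    ∃ g : ℝ → ℝ, MemLp g 2 ∧ ∀ a b, a ≤ b →
      realConv K U b - realConv K U a = ∫ x in a..b, g x := by
  set dU : ℝ → ℝ → ℝ := fun η x => U (x + η) - U x with hdU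
  have idU : ∀ η, Integrable (dU η) := fun η => (hU.comp_add_right η).sub hU
  have iprod : ∀ η {ψ : ℝ → ℝ}, MemLp ψ 2 → Integrable (fun x => dU η x * realConv K ψ x) :=
    fun η ψ hψ => (idU η).mul_bdd (continuous_realConv hK2 hψ).aestronglyMeasurable
      (Eventually.of_forall fun x => abs_realConv_le hK2 hψ x)
  -- As K is even, this is the pairing of the difference quotient of K * U with ψ, written so that
  -- the L¹ bound on the increments of U meets the sup bound on K * ψ.
  set L : ℝ → (Lp ℝ 2 (volume : Measure ℝ)) → ℝ := fun η ψ =>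
    η⁻¹ * ∫ x, dU η x * realConv K ψ x with hL
  have hadd : ∀ η ψ ψ', L η (ψ + ψ') = L η ψ + L η ψ' := by
    intro η ψ ψ'
    simp only [hL]
    rw [realConv_congr_right K (Lp.coeFn_add ψ ψ'), ← mul_add,
      ← integral_add (iprod η (Lp.memLp ψ)) (iprod η (Lp.memLp ψ'))]
    congr 2; ext x
    rw [← mul_add, ← realConv_add_right hK2 (Lp.memLp ψ) (Lp.memLp ψ')]
    rfl
  have hsmul : ∀ η (r : ℝ) ψ, L η (r • ψ) = r * L η ψ := by
    intro η r ψ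
    simp only [hL]
    rw [realConv_congr_right K (Lp.coeFn_smul r ψ)]
    have e : ∀ x, dU η x * realConv K (r • ⇑ψ) x = r * (dU η x * realConv K ψ x) := by
      intro x
      have : realConv K (r • ⇑ψ) x = r * realConv K ψ x := by
        simp only [realConv, ← integral_const_mul, Pi.smul_apply, smul_eq_mul, mul_left_comm]
      rw [this]; ring
    simp_rw [e]
    rw [integral_const_mul]; ring
  have hbound : ∀ η ∈ Ioo (0 : ℝ) 1, ∀ ψ, |L η ψ| ≤ (A * normL2 K) * ‖ψ‖ := by
    intro η hη ψ
    have e : normL2 ψ = ‖ψ‖ := rfl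
    simp only [hL]
    rw [abs_mul, abs_of_pos (inv_pos.2 hη.1), inv_mul_le_iff₀ hη.1]
    calc |∫ x, dU η x * realConv K ψ x| ≤ ∫ x, |dU η x| * (normL2 K * normL2 ψ) := by
          refine (abs_integral_le_integral_abs).trans
            (integral_mono (iprod η (Lp.memLp ψ)).abs ((idU η).abs.mul_const _) fun x => ?_)
          simp only [abs_mul]
          exact mul_le_mul_of_nonneg_left (abs_realConv_le hK2 (Lp.memLp ψ) x) (abs_nonneg _)
      _ = (∫ x, |dU η x|) * (normL2 K * normL2 ψ) := integral_mul_const _ _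
      _ ≤ (A * η) * (normL2 K * normL2 ψ) :=
          mul_le_mul_of_nonneg_right (hA η hη)
            (mul_nonneg (normL2_nonneg _) (normL2_nonneg _))
      _ = _ := by rw [e]; ring
  -- Along an ultrafilter the bounded family converges for every ψ at once and the limit is linear,
  -- with no subsequence to extract.
  set 𝒰 : Ultrafilter ℝ := Ultrafilter.of (𝓝[>] (0 : ℝ)) with hUf
  have hle : (𝒰 : Filter ℝ) ≤ 𝓝[>] 0 := Ultrafilter.of_le _
  have hIoo : ∀ᶠ η in (𝒰 : Filter ℝ), η ∈ Ioo (0 : ℝ) 1 := hle (Ioo_mem_nhdsGT one_pos)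
  have hlim : ∀ ψ, ∃ l, Tendsto (fun η => L η ψ) 𝒰 (𝓝 l) := by
    intro ψ
    set B := (A * normL2 K) * ‖ψ‖
    obtain ⟨l, _, hl⟩ := (isCompact_Icc (a := -B) (b := B)).ultrafilter_le_nhds'
      (𝒰.map fun η => L η ψ) (by
        rw [Ultrafilter.mem_map]
        filter_upwards [hIoo] with η hη using abs_le.1 (hbound η hη ψ))
    exact ⟨l, hl⟩
  choose l hl using hlim
  let T : Lp ℝ 2 (volume : Measure ℝ) →ₗ[ℝ] ℝ :=
    { toFun := l
      map_add' := fun ψ ψ' => tendsto_nhds_unique (hl (ψ + ψ'))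
        (((hl ψ).add (hl ψ')).congr fun η => (hadd η ψ ψ').symm)
      map_smul' := fun r ψ => tendsto_nhds_unique (hl (r • ψ))
        (((hl ψ).const_mul r).congr fun η => (hsmul η r ψ).symm) }
  let T' : Lp ℝ 2 (volume : Measure ℝ) →L[ℝ] ℝ := T.mkContinuous (A * normL2 K) fun ψ =>
    le_of_tendsto (hl ψ).abs (hIoo.mono fun η hη => hbound η hη ψ)
  set g := (InnerProductSpace.toDual ℝ _).symm T' with hg
  refine ⟨g, Lp.memLp g, fun a b hab => ?_⟩
  set F := realConv K U with hF
  have hFc : Continuous F := continuous_realConv hK2 hU2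
  set ψ := indicatorConstLp 2 (measurableSet_Ioc (a := a) (b := b)) (μ := volume)
    (by simp) (1 : ℝ) with hψ
  have e1 : l ψ = ∫ x in a..b, g x := by
    have : inner ℝ g ψ = T' ψ := InnerProductSpace.toDual_symm_apply
    rw [intervalIntegral.integral_of_le hab, ← L2.inner_indicatorConstLp_one (𝕜 := ℝ)
      measurableSet_Ioc (by simp), real_inner_comm]
    exact this.symm
  rw [← e1]
  refine tendsto_nhds_unique ?_ (hl ψ)
  -- For ψ the indicator of (a, b], the pairing telescopes into difference quotients of this
  -- antiderivative at b and at a, which tend to F(b) and F(a) by continuity of F.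
  set P : ℝ → ℝ := fun x => ∫ t in (0 : ℝ)..x, F t with hP
  have hPd : ∀ x, Tendsto (fun η => η⁻¹ * (P (x + η) - P x)) 𝒰 (𝓝 (F x)) := by
    intro x
    have h1 : HasDerivAt P (F x) x := intervalIntegral.integral_hasDerivAt_right
      (hFc.intervalIntegrable _ _) (hFc.stronglyMeasurableAtFilter _ _) hFc.continuousAt
    have h2 := hasDerivAt_iff_tendsto_slope_zero.1 h1
    simp only [smul_eq_mul] at h2
    exact h2.mono_left (hle.trans (nhdsWithin_mono 0 fun y hy => ne_of_gt hy))
  refine ((hPd b).sub (hPd a)).congr fun η => ?_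
  simp only [hL]
  have hind : (ψ : ℝ → ℝ) =ᵐ[volume] (Ioc a b).indicator fun _ => 1 := indicatorConstLp_coeFn
  rw [realConv_congr_right K hind, ← integral_mul_realConv_symm hK (idU η) heven
    (M := 1) (measurable_const.indicator measurableSet_Ioc).aestronglyMeasurable
    (fun x => by by_cases hx : x ∈ Ioc a b <;> simp [hx]), ← mul_sub]
  congr 1
  have hU2' : MemLp (fun x => U (x + η)) 2 :=
    hU2.comp_measurePreserving (measurePreserving_add_right volume η)
  have e2 : ∀ x, realConv K (dU η) x = F (x + η) - F x := by
    intro x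
    rw [hF, ← realConv_comp_add, ← realConv_sub_right hK2 hU2' hU2]
  have e3 : ∫ x, (Ioc a b).indicator (fun _ => (1 : ℝ)) x * realConv K (dU η) x =
      ∫ x in a..b, (F (x + η) - F x) := by
    rw [intervalIntegral.integral_of_le hab, ← integral_indicator measurableSet_Ioc]
    congr 1; ext x
    by_cases hx : x ∈ Ioc a b <;> simp [hx, e2]
  have hii : ∀ u v, IntervalIntegrable F volume u v := fun u v => hFc.intervalIntegrable u v
  rw [e3, intervalIntegral.integral_sub ((by fun_prop : Continuous fun x => F (x + η))
    |>.intervalIntegrable _ _) (hii a b), intervalIntegral.integral_comp_add_right]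
  simp only [hP]
  have q1 := intervalIntegral.integral_interval_sub_left (hii 0 (b + η)) (hii 0 (a + η))
  have q2 := intervalIntegral.integral_interval_sub_left (hii 0 b) (hii 0 a)
  linarith

/-! ### Punctured neighbourhoods and the blow-up criterion -/

/-- The punctured interval of radius `ε` around `0`. -/
def punctured (ε : ℝ) : Set ℝ := Ioo (-ε) 0 ∪ Ioo 0 ε

theorem isOpen_punctured (ε : ℝ) : IsOpen (punctured ε) := isOpen_Ioo.union isOpen_Ioo

theorem punctured_subset {ε ε' : ℝ} (h : ε ≤ ε') : punctured ε ⊆ punctured ε' := by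
  rintro x (hx | hx)
  · exact Or.inl ⟨by linarith [hx.1], hx.2⟩
  · exact Or.inr ⟨hx.1, by linarith [hx.2]⟩

theorem mem_punctured {ε x : ℝ} : x ∈ punctured ε ↔ x ≠ 0 ∧ -ε < x ∧ x < ε := by
  constructor
  · rintro (hx | hx)
    · exact ⟨hx.2.ne, hx.1, by linarith [hx.1, hx.2]⟩
    · exact ⟨hx.1.ne', by linarith [hx.1, hx.2], hx.2⟩
  · rintro ⟨h0, h1, h2⟩
    rcases lt_or_gt_of_ne h0 with h | h
    · exact Or.inl ⟨h1, h⟩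
    · exact Or.inr ⟨h, h2⟩

theorem eventually_subset_punctured {p : Set ℝ → Prop} (hp : ∀ s t, s ⊆ t → p t → p s)
    (h : ∃ ε > 0, p (punctured ε)) : ∀ᶠ ε in 𝓝[>] (0 : ℝ), p (punctured ε) := by
  obtain ⟨ε, hε, h⟩ := h
  filter_upwards [Ioo_mem_nhdsGT hε] with ε' hε' using hp _ _ (punctured_subset hε'.2.le) h

theorem exists_punctured_subset {O T : Set ℝ} (hO : O ∈ 𝓝 (0 : ℝ)) (hT : T.Finite) :
    ∃ ε > 0, punctured ε ⊆ O \ T := by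
  have h1 : (T \ {0})ᶜ ∈ 𝓝 (0 : ℝ) :=
    (hT.subset sdiff_subset).isClosed.isOpen_compl.mem_nhds (by simp)
  obtain ⟨ε, hε, hsub⟩ := Metric.mem_nhds_iff.1 (inter_mem hO h1)
  refine ⟨ε, hε, fun x hx => ?_⟩
  rw [mem_punctured] at hx
  have := hsub (show x ∈ Metric.ball 0 ε by
    rw [Metric.mem_ball, Real.dist_eq, sub_zero]; exact abs_lt.2 hx.2)
  exact ⟨this.1, fun hxT => this.2 ⟨hxT, hx.1⟩⟩

/-- Close to 0 the derivative of `v` is lam · c 0 · K plus terms with j bounded derivatives. This is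
the common end of both parts of the theorem: `v` is Lu in one and u in the other. -/
theorem KernelA1.singular_of_eq_primitive {K : ℝ → ℝ} {δ : ℝ} (hδ : 0 < δ) (h1 : KernelA1 K δ)
    (h2 : KernelA2 K δ) {j : ℕ} (hsing : UnboundedAtZero (iteratedDeriv j K)) {S : Finset ℝ}
    {c w v h h' : ℝ → ℝ} {lam : ℝ} (hlam : lam ≠ 0) (h0 : (0 : ℝ) ∈ S) (hc : c 0 ≠ 0)
    (hS : ∀ p ∈ S, p ≠ 0 → |p| ≠ δ ∨ j = 0) (hw : Integrable w)
    (hconv : ∃ ε > 0, SmoothBdd j (punctured ε) (realConv K w))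
    (hh' : ∃ ε > 0, SmoothBdd j (punctured ε) h')
    (hh : ∃ ε > 0, ∀ x ∈ punctured ε, HasDerivAt h (h' x) x)
    (hv : ∃ ε > 0, ∀ x ∈ punctured ε,
      v x = lam * primitive (fun t => realConv K w t + ∑ p ∈ S, c p * K (t - p)) x + h x) :
    ContDiffOffZero (j + 1) v ∧ UnboundedAtZero (iteratedDeriv (j + 1) v) ∧
      (InfiniteAtZero (iteratedDeriv j K) → InfiniteAtZero (iteratedDeriv (j + 1) v)) := by
  have hsb : ∀ {n : ℕ} {g : ℝ → ℝ} (s t : Set ℝ), s ⊆ t → SmoothBdd n t g → SmoothBdd n s g :=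
    fun s t hst h => h.mono hst
  have e1 := eventually_subset_punctured hsb hconv
  have e2 := eventually_subset_punctured hsb hh'
  have e3 := eventually_subset_punctured (p := fun s => ∀ x ∈ s, HasDerivAt h (h' x) x)
    (fun s t hst h x hx => h x (hst hx)) hh
  have e4 := eventually_subset_punctured (p := fun s => ∀ x ∈ s,
      v x = lam * primitive (fun t => realConv K w t + ∑ p ∈ S, c p * K (t - p)) x + h x)
    (fun s t hst h x hx => h x (hst hx)) hv
  have e5 : ∀ᶠ ε in 𝓝[>] (0 : ℝ), ∀ p ∈ S.erase 0,
      SmoothBdd j (punctured ε) (fun x => K (x - p)) := by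
    rw [Filter.eventually_all_finset]
    intro p hp
    rw [Finset.mem_erase] at hp
    exact eventually_subset_punctured hsb
      (h1.eventually_smoothBdd_comp_sub hδ h2 hp.1 (hS p hp.2 hp.1))
  have e6 : ∀ᶠ ε in 𝓝[>] (0 : ℝ), ε ∈ Ioo 0 δ := Ioo_mem_nhdsGT hδ
  obtain ⟨ε, e1, e2, e3, e4, e5, e6⟩ :=
    (e1.and (e2.and (e3.and (e4.and (e5.and e6))))).exists
  have hVo := isOpen_punctured ε
  have hKc : ContDiffOn ℝ ∞ K (punctured ε) := by
    refine (h1.contDiffOn h2).mono fun x hx => ?_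
    rw [mem_punctured] at hx
    simp only [mem_compl_iff, mem_insert_iff, mem_singleton_iff, not_or]
    exact ⟨hx.1, fun h => by linarith [e6.2], fun h => by linarith [e6.2]⟩
  have hsum := SmoothBdd.sum hVo (S.erase 0) fun p hp => (e5 p hp).const_mul (c p)
  have hB : SmoothBdd j (punctured ε) (fun x =>
      lam * (realConv K w x + ∑ p ∈ S.erase 0, c p * K (x - p)) + h' x) :=
    ((e1.add hVo hsum).const_mul lam).add hVo e2
  have hsplit : ∀ x, realConv K w x + ∑ p ∈ S, c p * K (x - p) =
      c 0 * K x + (realConv K w x + ∑ p ∈ S.erase 0, c p * K (x - p)) := by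
    intro x
    rw [← Finset.add_sum_erase S _ h0, sub_zero]; ring
  refine singular_of_deriv_eq (mul_ne_zero hlam hc) e6.1 (hKc.of_le (by exact_mod_cast le_top)) hB
    (fun x hx => ?_) hsing
  have hx : x ∈ punctured ε := hx
  have hcont : ContinuousAt (fun t => realConv K w t + ∑ p ∈ S, c p * K (t - p)) x := by
    simp_rw [hsplit]
    refine ContinuousOn.continuousAt (s := punctured ε) ?_ (hVo.mem_nhds hx)
    exact (continuousOn_const.mul hKc.continuousOn).add (e1.add hVo hsum).1.continuousOn
  have hd := ((hasDerivAt_primitive (integrable_realConv_add_jumps h1.integrable hw)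
    hcont).const_mul lam).add (e3 x hx)
  have hev : v =ᶠ[𝓝 x] fun x =>
      lam * primitive (fun t => realConv K w t + ∑ p ∈ S, c p * K (t - p)) x + h x := by
    filter_upwards [hVo.mem_nhds hx] with y hy using e4 y hy
  refine (hd.congr_of_eventuallyEq hev).congr_deriv ?_
  rw [hsplit]; ring

/-! ### Functions with a jump, and the operator as a convolution -/

theorem AssumptionB.smoothBdd {N : ℕ} {c d : ℝ} {g : ℝ → ℝ} (h : AssumptionB N c d g) :
    SmoothBdd N (Ioo c 0 ∪ Ioo 0 d) g :=
  ⟨h.smooth_left.union_of_isOpen h.smooth_right isOpen_Ioo isOpen_Ioo, h.bounded⟩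

/-- A function with a jump at the origin is piecewise a primitive of its derivative. -/
theorem AssumptionB.exists_primitive {N : ℕ} {c d : ℝ} {g : ℝ → ℝ} (h : AssumptionB (N + 1) c d g)
    (hc : c < 0) (hd : 0 < d) :
    ∃ (w : ℝ → ℝ) (C₁ C₂ : ℝ), Integrable w ∧ MemLp w 2 ∧ C₁ ≠ C₂ ∧
      (∀ x ∈ Ioo c 0, g x = C₁ + primitive w x) ∧ (∀ x ∈ Ioo 0 d, g x = C₂ + primitive w x) ∧
      (∀ x ∈ Ioo c 0 ∪ Ioo 0 d, HasDerivAt g (w x) x) ∧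
      SmoothBdd N (Ioo c 0 ∪ Ioo 0 d) w := by
  set V := Ioo c 0 ∪ Ioo 0 d with hV
  have hVo : IsOpen V := isOpen_Ioo.union isOpen_Ioo
  set w := V.indicator (deriv g) with hw
  have hwe : EqOn w (deriv g) V := fun x hx => indicator_of_mem hx _
  have hsb : SmoothBdd N V w := (h.smoothBdd.deriv hVo).congr hVo hwe
  obtain ⟨M, hM⟩ := hsb.2 0 (by omega)
  simp only [iteratedDeriv_zero] at hM
  have hlp : ∀ p : ENNReal, MemLp w p := by
    intro p
    have hfin : volume V < ⊤ := by
      refine (measure_union_le _ _).trans_lt ?_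
      simp [ENNReal.add_lt_top]
    have : MemLp (deriv g) p (volume.restrict V) := by
      have : IsFiniteMeasure (volume.restrict V) := ⟨by simpa using hfin⟩
      refine MemLp.of_bound (measurable_deriv g).aestronglyMeasurable M ?_
      filter_upwards [ae_restrict_mem hVo.measurableSet] with x hx
      rw [← hwe hx]; exact hM x hx
    exact (memLp_indicator_iff_restrict hVo.measurableSet).2 this
  have hwi : Integrable w := memLp_one_iff_integrable.1 (hlp 1)
  have hder : ∀ x ∈ V, HasDerivAt g (w x) x := by
    intro x hx
    rw [hwe hx]
    exact ((h.smoothBdd.contDiffAt hVo hx le_rfl).differentiableAt (by simp)).hasDerivAt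
  obtain ⟨C₁, hC₁⟩ := exists_eq_const_add_primitive hc hwi fun x hx => hder x (Or.inl hx)
  obtain ⟨C₂, hC₂⟩ := exists_eq_const_add_primitive hd hwi fun x hx => hder x (Or.inr hx)
  -- The primitive is continuous at 0, so the jump of g there is exactly C₂ - C₁.
  refine ⟨w, C₁, C₂, hwi, hlp 2, fun hCC => ?_, hC₁, hC₂, hder, hsb⟩
  obtain ⟨l, r, hl, hr, hlr⟩ := h.jump
  have hp := (continuous_primitive hwi).tendsto 0
  refine hlr ?_
  have el : l = C₁ + primitive w 0 := by
    refine tendsto_nhds_unique (hl.congr' ?_) ((hp.const_add C₁).mono_left nhdsWithin_le_nhds)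
    filter_upwards [Ioo_mem_nhdsLT hc] with x hx using hC₁ x hx
  have er : r = C₂ + primitive w 0 := by
    refine tendsto_nhds_unique (hr.congr' ?_) ((hp.const_add C₂).mono_left nhdsWithin_le_nhds)
    filter_upwards [Ioo_mem_nhdsGT hd] with x hx using hC₂ x hx
  rw [el, er, hCC]

theorem nlDomain_union_nlCollar {a₁ a₂ δ : ℝ} (ha : a₁ < a₂) (hδ : 0 < δ) :
    nlDomain a₁ a₂ ∪ nlCollar a₁ a₂ δ = Ioo (a₁ - δ) (a₂ + δ) := by
  ext x
  simp only [nlDomain, nlCollar, mem_union, mem_Ioo, mem_Ioc, mem_Ico]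
  constructor
  · rintro (h | h | h) <;> constructor <;> linarith
  · intro h
    rcases le_or_gt x a₁ with h1 | h1
    · exact Or.inr (Or.inl ⟨h.1, h1⟩)
    · rcases lt_or_ge x a₂ with h2 | h2
      · exact Or.inl ⟨h1, h2⟩
      · exact Or.inr (Or.inr ⟨h2, h.2⟩)

/-- From x ∈ Ω the kernel reaches no further than the collar, so ∫ K(x - y) dy over Ω ∪ Ω_I is the
full mass κ. -/
theorem nlLaplacian_eq {K : ℝ → ℝ} {a₁ a₂ δ : ℝ} (ha : a₁ < a₂) (hδ : 0 < δ) (h1 : KernelA1 K δ)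
    (hK2 : MemLp K 2) {u : ℝ → ℝ}
    (hu : MemLp u 2 (volume.restrict (nlDomain a₁ a₂ ∪ nlCollar a₁ a₂ δ))) {x : ℝ}
    (hx : x ∈ Ioo a₁ a₂) :
    nlLaplacian K a₁ a₂ δ u x =
      realConv K ((Ioo (a₁ - δ) (a₂ + δ)).indicator u) x - (∫ t, K t) * u x := by
  unfold nlLaplacian
  rw [nlDomain_union_nlCollar ha hδ] at hu ⊢
  set D := Ioo (a₁ - δ) (a₂ + δ)
  have hUm : MemLp (D.indicator u) 2 := (memLp_indicator_iff_restrict measurableSet_Ioo).2 hu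
  have hKabs : ∀ y, K |x - y| = K (x - y) := by
    intro y
    rcases abs_choice (x - y) with h | h <;> rw [h]
    exact h1.radial _
  have i1 : Integrable (fun y => D.indicator u y * K (x - y)) :=
    integrable_realConv_integrand hUm hK2 x
  have i2 : Integrable (fun y => K (x - y)) := h1.integrable.comp_sub_left x
  have e : ∀ y, D.indicator (fun y => (u y - u x) * K |x - y|) y =
      D.indicator u y * K (x - y) - u x * K (x - y) := by
    intro y
    rw [← sub_mul]
    by_cases hy : y ∈ D
    · rw [indicator_of_mem hy, indicator_of_mem hy, hKabs]
    · rw [indicator_of_notMem hy, indicator_of_notMem hy, h1.support, mul_zero]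
      by_contra hc
      rw [not_le, abs_lt] at hc
      exact hy ⟨by linarith [hx.1, hc.2], by linarith [hx.2, hc.1]⟩
  rw [← integral_indicator measurableSet_Ioo, integral_congr_ae (Eventually.of_forall e),
    integral_sub i1 (i2.const_mul _), integral_const_mul,
    integral_sub_left_eq_self K volume x, realConv_comm, mul_comm (u x)]
  rfl

/-- A nonnegative kernel of mass zero vanishes a.e., hence everywhere on (0, δ) by continuity, and
then its j-th derivative is not singular. -/
theorem KernelA1.integral_pos {K : ℝ → ℝ} {δ : ℝ} (hδ : 0 < δ) (h1 : KernelA1 K δ)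
    (h2 : KernelA2 K δ) {j : ℕ} (hsing : UnboundedAtZero (iteratedDeriv j K)) : 0 < ∫ t, K t := by
  refine lt_of_le_of_ne (integral_nonneg h1.nonneg) fun h0 => ?_
  have hz := (integral_eq_zero_iff_of_nonneg h1.nonneg h1.integrable).1 h0.symm
  have he : EqOn K (fun _ => 0) (Ioo 0 δ) :=
    Measure.eqOn_open_of_ae_eq (ae_restrict_of_ae hz) isOpen_Ioo h2.smooth_right.continuousOn
      continuousOn_const
  obtain ⟨x, hx, hx'⟩ := ((hsing.2 0).and_eventually (Ioo_mem_nhdsGT hδ)).exists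
  rw [he.iteratedDeriv_of_isOpen isOpen_Ioo j hx'] at hx
  simp at hx

/-! ### From a jump of u to a singularity of Lu -/

/-- The nonlocal operator turns a jump into a singular derivative. -/
theorem singular_nlLaplacian {a₁ a₂ δ : ℝ} (ha₁ : a₁ < 0) (ha₂ : 0 < a₂) (hδ : 0 < δ) {K : ℝ → ℝ}
    (h1 : KernelA1 K δ) (h2 : KernelA2 K δ) {j N : ℕ} (hN : j + 1 ≤ N)
    (hbdd : ∀ i < j, MemLp (iteratedDeriv i K) ⊤ volume)
    (hL2 : MemLp (iteratedDeriv j K) 2 volume)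
    (hsing : UnboundedAtZero (iteratedDeriv j K)) {u : ℝ → ℝ} {c₁ c₂ : ℝ} (hac₁ : a₁ - δ ≤ c₁)
    (hc₁ : c₁ < -δ) (hc₂ : δ < c₂) (hac₂ : c₂ ≤ a₂ + δ)
    (hu : MemLp u 2 (volume.restrict (nlDomain a₁ a₂ ∪ nlCollar a₁ a₂ δ)))
    (hB : AssumptionB N c₁ c₂ u) :
    ContDiffOffZero (j + 1) (nlLaplacian K a₁ a₂ δ u) ∧
      UnboundedAtZero (iteratedDeriv (j + 1) (nlLaplacian K a₁ a₂ δ u)) ∧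
      (InfiniteAtZero (iteratedDeriv j K) →
        InfiniteAtZero (iteratedDeriv (j + 1) (nlLaplacian K a₁ a₂ δ u))) := by
  obtain ⟨N, rfl⟩ : ∃ n, N = n + 1 := ⟨N - 1, by omega⟩
  have hc₁0 : c₁ < 0 := by linarith
  have hc₂0 : 0 < c₂ := by linarith
  obtain ⟨w, C₁, C₂, hwi, hw2, hCC, hg₁, hg₂, hder, hsb⟩ := hB.exists_primitive hc₁0 hc₂0
  have hsb := hsb.of_le (show j ≤ N by omega)
  obtain ⟨J, hJ, -⟩ := h1.exists_kernelTower hδ h2 hbdd hL2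
  have hK2 : MemLp K 2 := by simpa using hJ.memLp 0 (Nat.zero_le j)
  set κ := ∫ t, K t with hκ
  set U := (Ioo c₁ c₂).indicator u with hU
  set S : Finset ℝ := {c₁, 0, c₂} with hS
  have hind : ∀ g : ℝ → ℝ, (fun x => (Ioo c₁ 0).indicator g x + (Ioo 0 c₂).indicator g x)
      =ᵐ[volume] (Ioo c₁ c₂).indicator g := by
    intro g
    filter_upwards [compl_mem_ae_iff.2 (measure_singleton (μ := volume) (0 : ℝ))] with x hx
    have hx : x ≠ 0 := hx
    rcases lt_or_gt_of_ne hx with h | h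
    · have : ¬ 0 < x := not_lt.2 h.le
      have h3 : x < c₂ := h.trans hc₂0
      simp [indicator_apply, h, this, h3]
    · have : ¬ x < 0 := not_lt.2 h.le
      have h3 : c₁ < x := hc₁0.trans h
      simp [indicator_apply, h, this, h3]
  set w' := (Ioo c₁ c₂).indicator w with hw'
  obtain ⟨c, hc, hPP⟩ : ∃ c : ℝ → ℝ, c 0 = C₂ - C₁ ∧ PiecewisePrimitive S c w' U := by
    refine ⟨_, ?_, ((PiecewisePrimitive.indicator_Ioo (S := S) hwi hc₁0 (by simp [hS])
      (by simp [hS]) (Eventually.of_forall hg₁)).add (hwi.indicator measurableSet_Ioo)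
        (hwi.indicator measurableSet_Ioo)
      (PiecewisePrimitive.indicator_Ioo (S := S) hwi hc₂0 (by simp [hS]) (by simp [hS])
        (Eventually.of_forall hg₂))).congr (hind w) (hind u)⟩
    simp only [Pi.add_apply, if_true, hc₁0.ne', if_false]
    ring
  have hwi' : Integrable w' := hwi.indicator measurableSet_Ioo
  have hw2' : MemLp w' 2 := hw2.indicator measurableSet_Ioo
  have hV0 : IsOpen (Ioo c₁ 0 ∪ Ioo 0 c₂) := isOpen_Ioo.union isOpen_Ioo
  have hsb' : SmoothBdd j (Ioo c₁ 0 ∪ Ioo 0 c₂) w' := by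
    refine hsb.congr hV0 fun x hx => indicator_of_mem ?_ _
    rcases hx with hx | hx
    · exact ⟨hx.1, hx.2.trans hc₂0⟩
    · exact ⟨hc₁0.trans hx.1, hx.2⟩
  -- For 0 < |x| < ρ, the points x and x ± δ lie in (c₁, c₂) and avoid 0, x lies in Ω, and the
  -- window (x - δ, x + δ) stays inside (c₁, c₂), so K * u sees only the cut-off U.
  set ρ := min (min δ (c₂ - δ)) (min (-δ - c₁) (min (-a₁) a₂)) with hρ
  have hρ0 : 0 < ρ := by simp only [hρ, lt_min_iff]; refine ⟨⟨?_, ?_⟩, ?_, ?_, ?_⟩ <;> linarith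
  have hρ1 : ρ ≤ δ := (min_le_left _ _).trans (min_le_left _ _)
  have hρ2 : ρ ≤ c₂ - δ := (min_le_left _ _).trans (min_le_right _ _)
  have hρ3 : ρ ≤ -δ - c₁ := (min_le_right _ _).trans (min_le_left _ _)
  have hρ4 : ρ ≤ -a₁ := (min_le_right _ _).trans ((min_le_right _ _).trans (min_le_left _ _))
  have hρ5 : ρ ≤ a₂ := (min_le_right _ _).trans ((min_le_right _ _).trans (min_le_right _ _))
  have hsub : punctured ρ ⊆ Ioo c₁ 0 ∪ Ioo 0 c₂ := by
    rintro x (hx | hx)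
    · exact Or.inl ⟨by linarith [hx.1], hx.2⟩
    · exact Or.inr ⟨hx.1, by linarith [hx.2]⟩
  refine h1.singular_of_eq_primitive hδ h2 hsing (S := S) (c := c) (w := w') (lam := 1)
    (h := fun x => -κ * u x) (h' := fun x => -κ * w x) one_ne_zero (by simp [hS]) ?_ ?_ hwi'
    ⟨ρ, hρ0, ?_⟩ ⟨ρ, hρ0, (hsb.mono hsub).const_mul _⟩
    ⟨ρ, hρ0, fun x hx => (hder x (hsub hx)).const_mul _⟩ ⟨ρ, hρ0, fun x hx => ?_⟩
  · rw [hc, sub_ne_zero]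
    exact hCC.symm
  · intro p hp hp0
    left
    simp only [hS, Finset.mem_insert, Finset.mem_singleton] at hp
    rcases hp with rfl | rfl | rfl
    · rw [abs_of_neg hc₁0]; linarith
    · exact absurd rfl hp0
    · rw [abs_of_pos hc₂0]; linarith
  · have := hJ.smoothBdd_realConv hw2' hwi' (isOpen_punctured ρ) j 0 (by omega)
      fun q hq _ m hm => (hsb'.comp_sub (V' := punctured ρ) (q := q) fun x hx => by
        rw [mem_punctured] at hx
        simp only [Finset.mem_insert, Finset.mem_singleton] at hq
        rcases hq with rfl | rfl | rfl
        · exact hsub (mem_punctured.2 (by simpa using hx))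
        · exact Or.inl ⟨by linarith, by linarith⟩
        · exact Or.inr ⟨by linarith, by linarith⟩).of_le hm.le
    simpa using this
  · rw [mem_punctured] at hx
    rw [nlLaplacian_eq (by linarith) hδ h1 hK2 hu ⟨by linarith, by linarith⟩,
      ← hPP.realConv_eq h1.integrable hwi', one_mul, sub_eq_add_neg, neg_mul]
    congr 1
    unfold realConv
    congr 1; ext t
    rcases le_or_gt δ |t| with ht | ht
    · simp [h1.support t ht]
    · rw [abs_lt] at ht
      rw [hU, indicator_of_mem, indicator_of_mem] <;> constructor <;> linarith

/-! ### From a jump of f to a singularity of the solution -/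

theorem ae_hasDerivAt_primitive {w : ℝ → ℝ} (hw : Integrable w) :
    ∀ᵐ x, HasDerivAt (primitive w) (w x) x := by
  have : primitive w = fun x => primitive w 0 + ∫ t in (0 : ℝ)..x, w t := by
    ext x; rw [← primitive_sub_primitive hw]; ring
  filter_upwards [LocallyIntegrable.ae_hasDerivAt_integral hw.locallyIntegrable] with x hx
  rw [this]
  exact (hx 0).const_add _

theorem memLp_integrable_indicator_Ioo {g : ℝ → ℝ} {V : Set ℝ} {p q : ℝ} (hV : Ioo p q ⊆ V)
    (hg : MemLp g 2 (volume.restrict V)) :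
    MemLp ((Ioo p q).indicator g) 2 ∧ Integrable ((Ioo p q).indicator g) := by
  have h := hg.mono_measure (Measure.restrict_mono_set volume hV)
  exact ⟨(memLp_indicator_iff_restrict measurableSet_Ioo).2 h,
    (integrable_indicator_iff measurableSet_Ioo).2 (h.integrable (by norm_num))⟩

/-- A solution of the nonlocal problem is, piecewise, the primitive of a solution of the
differentiated equation. -/
theorem IsNlSolution.exists_primitive {a₁ a₂ δ : ℝ} (ha₁ : a₁ < 0) (ha₂ : 0 < a₂) (hδ : 0 < δ)
    {K : ℝ → ℝ} (h1 : KernelA1 K δ) (hK2 : MemLp K 2) (hκ : 0 < ∫ t, K t) {N : ℕ}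
    {f b u : ℝ → ℝ} (hf : AssumptionB (N + 1) a₁ a₂ f)
    (hb : MemW12 (interior (nlCollar a₁ a₂ δ)) b) (hu : IsNlSolution K a₁ a₂ δ f b u) :
    ∃ w wf c : ℝ → ℝ, Integrable w ∧ MemLp w 2 ∧ c 0 ≠ 0 ∧
      (∀ x ∈ Ioo a₁ a₂, (∫ t, K t) * w x = realConv K w x +
        (∑ p ∈ {a₁ - δ, a₁, 0, a₂, a₂ + δ}, c p * K (x - p) - wf x)) ∧
      (∀ x, realConv K ((Ioo (a₁ - δ) (a₂ + δ)).indicator u) x = primitive (fun t =>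
        realConv K w t + ∑ p ∈ {a₁ - δ, a₁, 0, a₂, a₂ + δ}, c p * K (t - p)) x) ∧
      (∀ x ∈ Ioo a₁ 0 ∪ Ioo 0 a₂, HasDerivAt f (wf x) x) ∧
      SmoothBdd N (Ioo a₁ 0 ∪ Ioo 0 a₂) wf := by
  set κ := ∫ t, K t with hκdef
  set S : Finset ℝ := {a₁ - δ, a₁, 0, a₂, a₂ + δ} with hS
  set V := interior (nlCollar a₁ a₂ δ) with hV
  have haa : a₁ < a₂ := ha₁.trans ha₂
  have hIL : Ioo (a₁ - δ) a₁ ⊆ V :=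
    interior_maximal (fun x hx => Or.inl ⟨hx.1, hx.2.le⟩) isOpen_Ioo
  have hIR : Ioo a₂ (a₂ + δ) ⊆ V :=
    interior_maximal (fun x hx => Or.inr ⟨hx.1.le, hx.2⟩) isOpen_Ioo
  obtain ⟨wf, Cf₁, Cf₂, hwf, hwf2, hCf, hf₁, hf₂, hfd, hfs⟩ := hf.exists_primitive ha₁ ha₂
  obtain ⟨hb2, b', hb2', hbw⟩ := hb
  obtain ⟨ib₁, C₁, hC₁⟩ := exists_ae_eq_const_add_primitive_of_weakDeriv (by linarith) hIL hb2
    hb2' hbw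
  obtain ⟨ib₄, C₄, hC₄⟩ := exists_ae_eq_const_add_primitive_of_weakDeriv (by linarith) hIR hb2
    hb2' hbw
  have iw₁ := ib₁.indicator (measurableSet_Ioo (a := a₁ - δ) (b := a₁))
  have iw₄ := ib₄.indicator (measurableSet_Ioo (a := a₂) (b := a₂ + δ))
  have hm₁ : a₁ - δ ∈ S ∧ a₁ ∈ S ∧ (0 : ℝ) ∈ S ∧ a₂ ∈ S ∧ a₂ + δ ∈ S := by simp [hS]
  have P₁ := PiecewisePrimitive.indicator_Ioo (S := S) ib₁ (by linarith : a₁ - δ < a₁) hm₁.1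
    hm₁.2.1 hC₁
  have P₄ := PiecewisePrimitive.indicator_Ioo (S := S) ib₄ (by linarith : a₂ < a₂ + δ)
    hm₁.2.2.2.1 hm₁.2.2.2.2 hC₄
  have Pf := (PiecewisePrimitive.indicator_Ioo (S := S) hwf ha₁ hm₁.2.1 hm₁.2.2.1
    (Eventually.of_forall hf₁)).add (hwf.indicator measurableSet_Ioo)
      (hwf.indicator measurableSet_Ioo)
    (PiecewisePrimitive.indicator_Ioo (S := S) hwf ha₂ hm₁.2.2.1 hm₁.2.2.2.1
      (Eventually.of_forall hf₂))
  set Uo : ℝ → ℝ := fun x => (Ioo (a₁ - δ) a₁).indicator b x + (Ioo a₂ (a₂ + δ)).indicator b x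
    with hUo
  set Ui : ℝ → ℝ := (Ioo a₁ a₂).indicator u with hUi
  set fe : ℝ → ℝ := fun x => (Ioo a₁ 0).indicator f x + (Ioo 0 a₂).indicator f x with hfe
  have hu2 := hu.memLp
  rw [nlDomain_union_nlCollar haa hδ] at hu2
  obtain ⟨hUi2, hUi1⟩ := memLp_integrable_indicator_Ioo (V := Ioo (a₁ - δ) (a₂ + δ))
    (p := a₁) (q := a₂) (fun x hx => ⟨by linarith [hx.1], by linarith [hx.2]⟩) hu2
  obtain ⟨hbL2, hbL1⟩ := memLp_integrable_indicator_Ioo hIL hb2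
  obtain ⟨hbR2, hbR1⟩ := memLp_integrable_indicator_Ioo hIR hb2
  have hUo2 : MemLp Uo 2 := hbL2.add hbR2
  have hUo1 : Integrable Uo := hbL1.add hbR1
  have hfin : ({a₁, 0, a₂}ᶜ : Set ℝ) ∈ ae volume :=
    compl_mem_ae_iff.2 ((Set.toFinite _).measure_zero volume)
  have hcon : ∀ᵐ x, x ∈ nlCollar a₁ a₂ δ → u x = b x :=
    (ae_restrict_iff' (measurableSet_Ioc.union measurableSet_Ico)).1 hu.constraint
  have hU : (fun x => Ui x + Uo x) =ᵐ[volume] (Ioo (a₁ - δ) (a₂ + δ)).indicator u := by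
    filter_upwards [hfin, hcon] with x hx hxc
    simp only [mem_compl_iff, mem_insert_iff, mem_singleton_iff, not_or] at hx
    simp only [hUi, hUo, indicator_apply, mem_Ioo]
    rcases lt_or_gt_of_ne hx.1 with h | h
    · by_cases h' : a₁ - δ < x
      · rw [hxc (Or.inl ⟨h', h.le⟩)]
        simp [h, h', not_lt.2 h.le, not_lt.2 (h.trans haa).le, (by linarith : x < a₂ + δ)]
      · simp [h', not_lt.2 h.le, not_lt.2 (h.trans haa).le]
    · rcases lt_or_gt_of_ne hx.2.2 with h2 | h2
      · simp [h, h2, not_lt.2 h.le, not_lt.2 h2.le, (by linarith : x < a₂ + δ),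
          (by linarith : a₁ - δ < x)]
      · by_cases h' : x < a₂ + δ
        · rw [hxc (Or.inr ⟨h2.le, h'⟩)]
          simp [h', h2, not_lt.2 h.le, not_lt.2 h2.le, (by linarith : a₁ - δ < x)]
        · simp [h', not_lt.2 h.le, not_lt.2 h2.le]
  set F := realConv K (fun y => Ui y + Uo y) with hF
  have hFU : F = realConv K ((Ioo (a₁ - δ) (a₂ + δ)).indicator u) := realConv_congr_right K hU
  have heqn : ∀ᵐ x, x ∈ Ioo a₁ a₂ → κ * u x = F x - f x := by
    have := (ae_restrict_iff' measurableSet_Ioo).1 hu.eqn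
    filter_upwards [this] with x hx hxI
    have h3 := hx hxI
    rw [nlLaplacian_eq haa hδ h1 hK2 hu.memLp hxI, ← hFU] at h3
    linarith
  have heq : ∀ᵐ x, κ * Ui x = (Ioo a₁ a₂).indicator F x - fe x := by
    filter_upwards [heqn, hfin] with x hx hx0
    simp only [mem_compl_iff, mem_insert_iff, mem_singleton_iff, not_or] at hx0
    by_cases hxI : x ∈ Ioo a₁ a₂
    · have : fe x = f x := by
        rcases lt_or_gt_of_ne hx0.2.1 with h | h
        · simp [hfe, indicator_apply, h, hxI.1, not_lt.2 h.le]
        · simp [hfe, indicator_apply, h, hxI.2, not_lt.2 h.le]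
      rw [hUi, indicator_of_mem hxI, indicator_of_mem hxI, hx hxI, this]
    · have h3 : x ∉ Ioo a₁ 0 := fun h => hxI ⟨h.1, h.2.trans ha₂⟩
      have h4 : x ∉ Ioo 0 a₂ := fun h => hxI ⟨ha₁.trans h.1, h.2⟩
      simp only [hUi, hfe, indicator_of_notMem hxI, indicator_of_notMem h3,
        indicator_of_notMem h4]
      ring
  obtain ⟨A, hA⟩ := h1.exists_integral_abs_diff_le hδ hκ hK2 haa (iw₁.add iw₄)
    ((hwf.indicator measurableSet_Ioo).add (hwf.indicator measurableSet_Ioo))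
    (P₁.add iw₁ iw₄ P₄) Pf hUi1 hUi2 hUo2 (fun x hx => indicator_of_notMem hx _) heq
  obtain ⟨g, hg2, hg⟩ := exists_memLp_integral_eq_of_diff_le h1.integrable hK2 h1.radial
    (hUi1.add hUo1) (hUi2.add hUo2) hA
  have hg : ∀ x y, x ≤ y → F y - F x = ∫ t in x..y, g t := hg
  set g₁ := (Ioo a₁ a₂).indicator g with hg₁
  obtain ⟨ig₂, ig₁⟩ := memLp_integrable_indicator_Ioo (p := a₁) (q := a₂) (subset_univ _)
    (by simpa using hg2)
  have hFp0 : ∀ x ∈ Ioo a₁ a₂, ∀ y ∈ Ioo a₁ a₂, x ≤ y →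
      F y - F x = primitive g₁ y - primitive g₁ x := by
    intro x hx y hy hxy
    rw [hg x y hxy, primitive_sub_primitive ig₁]
    refine intervalIntegral.integral_congr fun t ht => ?_
    rw [uIcc_of_le hxy] at ht
    have : t ∈ Ioo a₁ a₂ := ⟨hx.1.trans_le ht.1, ht.2.trans_lt hy.2⟩
    simp only [indicator_of_mem this]
  set CF := F 0 - primitive g₁ 0 with hCF
  have hFp : ∀ x ∈ Ioo a₁ a₂, F x = CF + primitive g₁ x := by
    intro x hx
    rcases le_total 0 x with h | h
    · linarith [hFp0 0 ⟨ha₁, ha₂⟩ x hx h]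
    · linarith [hFp0 x hx 0 ⟨ha₁, ha₂⟩ h]
  -- The derivative of u = κ⁻¹ (F - f) on each side of 0. As F is a single primitive across 0, the
  -- constants of u there differ only through `Cf₁` and `Cf₂`.
  set wm : ℝ → ℝ := fun x => κ⁻¹ * (g₁ x - wf x) with hwm
  have iwm : Integrable wm := (ig₁.sub hwf).const_mul _
  have wm2 : MemLp wm 2 := (ig₂.sub hwf2).const_mul _
  have hpwm : ∀ x, primitive wm x = κ⁻¹ * (primitive g₁ x - primitive wf x) := by
    intro x
    unfold primitive
    rw [integral_const_mul, integral_sub ig₁.restrict hwf.restrict]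
  have hup : ∀ x, κ * u x = F x - f x → x ∈ Ioo a₁ a₂ → ∀ Cf, f x = Cf + primitive wf x →
      u x = κ⁻¹ * (CF - Cf) + primitive wm x := by
    intro x hx hxI Cf hfx
    rw [hpwm, ← mul_add, eq_inv_mul_iff_mul_eq₀ hκ.ne', hx, hFp x hxI, hfx]
    ring
  have P₂ := PiecewisePrimitive.indicator_Ioo (S := S) (g := u) (C := κ⁻¹ * (CF - Cf₁)) iwm ha₁
    hm₁.2.1 hm₁.2.2.1 (by
      filter_upwards [heqn] with x hx hxI
      have hxI' : x ∈ Ioo a₁ a₂ := ⟨hxI.1, hxI.2.trans ha₂⟩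
      exact hup x (hx hxI') hxI' _ (hf₁ x hxI))
  have P₃ := PiecewisePrimitive.indicator_Ioo (S := S) (g := u) (C := κ⁻¹ * (CF - Cf₂)) iwm ha₂
    hm₁.2.2.1 hm₁.2.2.2.1 (by
      filter_upwards [heqn] with x hx hxI
      have hxI' : x ∈ Ioo a₁ a₂ := ⟨ha₁.trans hxI.1, hxI.2⟩
      exact hup x (hx hxI') hxI' _ (hf₂ x hxI))
  have iw₂ := iwm.indicator (measurableSet_Ioo (a := a₁) (b := 0))
  have iw₃ := iwm.indicator (measurableSet_Ioo (a := 0) (b := a₂))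
  set b₁ := (Ioo (a₁ - δ) a₁).indicator b' with hb₁
  set b₄ := (Ioo a₂ (a₂ + δ)).indicator b' with hb₄
  set w₀ : ℝ → ℝ := fun x => (Ioo (a₁ - δ) a₁).indicator b₁ x + ((Ioo a₁ 0).indicator wm x +
    ((Ioo 0 a₂).indicator wm x + (Ioo a₂ (a₂ + δ)).indicator b₄ x)) with hw₀
  have hw₀i : Integrable w₀ := iw₁.add (iw₂.add (iw₃.add iw₄))
  have hw₀2 : MemLp w₀ 2 :=
    ((memLp_integrable_indicator_Ioo hIL hb2').1.indicator measurableSet_Ioo).add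
      ((wm2.indicator measurableSet_Ioo).add ((wm2.indicator measurableSet_Ioo).add
        ((memLp_integrable_indicator_Ioo hIR hb2').1.indicator measurableSet_Ioo)))
  obtain ⟨c, hc0, hPP⟩ : ∃ c : ℝ → ℝ, c 0 ≠ 0 ∧
      PiecewisePrimitive S c w₀ (fun x => Ui x + Uo x) := by
    refine ⟨_, ?_, (P₁.add iw₁ (iw₂.add (iw₃.add iw₄)) (P₂.add iw₂ (iw₃.add iw₄)
      (P₃.add iw₃ iw₄ P₄))).congr (ae_eq_refl w₀) ?_⟩
    · have n1 : (0 : ℝ) ≠ a₁ - δ := by linarith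
      have n2 : (0 : ℝ) ≠ a₂ + δ := by linarith
      simp only [Pi.add_apply, if_true, ha₁.ne', ha₂.ne, n1, n2, if_false]
      intro h
      have h5 : κ⁻¹ * (Cf₁ - Cf₂) = 0 := by linarith
      rcases mul_eq_zero.1 h5 with h6 | h6
      · exact hκ.ne' (inv_eq_zero.1 h6)
      · exact hCf (sub_eq_zero.1 h6)
    · filter_upwards [hfin] with x hx0
      simp only [mem_compl_iff, mem_insert_iff, mem_singleton_iff, not_or] at hx0
      have : Ui x = (Ioo a₁ 0).indicator u x + (Ioo 0 a₂).indicator u x := by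
        simp only [hUi, indicator_apply, mem_Ioo]
        rcases lt_or_gt_of_ne hx0.2.1 with h | h
        · simp [h, not_lt.2 h.le, h.trans ha₂]
        · simp [h, not_lt.2 h.le, ha₁.trans h]
      rw [this, hUo]; ring
  set gt : ℝ → ℝ := fun t => realConv K w₀ t + ∑ p ∈ S, c p * K (t - p) with hgt
  have hgti : Integrable gt := integrable_realConv_add_jumps h1.integrable hw₀i
  have hFg : ∀ x, F x = primitive gt x := fun x => hPP.realConv_eq h1.integrable hw₀i x
  -- Both are a.e. derivatives of F: `g₁` comes from Riesz representation, `gt` from the piecewise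
  -- primitive U.
  have hgg : ∀ᵐ x, x ∈ Ioo a₁ a₂ → gt x = g₁ x := by
    filter_upwards [ae_hasDerivAt_primitive hgti, ae_hasDerivAt_primitive ig₁] with x hx hx' hxI
    refine hx.unique ((hx'.const_add CF).congr_of_eventuallyEq ?_)
    filter_upwards [isOpen_Ioo.mem_nhds hxI] with y hy
    rw [← hFg, hFp y hy]
  -- A representative for which the differentiated equation holds at every point of Ω; the bootstrap
  -- reads pointwise smoothness of w from it.
  set w : ℝ → ℝ := fun x => open Classical in
    if x ∈ Ioo a₁ a₂ then κ⁻¹ * (gt x - wf x) else w₀ x with hw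
  have hww : w =ᵐ[volume] w₀ := by
    filter_upwards [hgg, hfin] with x hx hx0
    simp only [mem_compl_iff, mem_insert_iff, mem_singleton_iff, not_or] at hx0
    by_cases hxI : x ∈ Ioo a₁ a₂
    · have e : w₀ x = wm x := by
        simp only [hw₀, indicator_apply, mem_Ioo]
        rcases lt_or_gt_of_ne hx0.2.1 with h | h
        · simp [h, not_lt.2 h.le, hxI.1, not_lt.2 hxI.1.le, not_lt.2 hxI.2.le]
        · simp [h, not_lt.2 h.le, hxI.2, not_lt.2 hxI.1.le, not_lt.2 hxI.2.le]
      rw [hw, e]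
      simp only [if_pos hxI, hwm, hx hxI]
    · simp only [hw, if_neg hxI]
  have hconv : realConv K w = realConv K w₀ := realConv_congr_right K hww
  refine ⟨w, wf, c, hw₀i.congr hww.symm, (memLp_congr_ae hww).2 hw₀2, hc0, fun x hx => ?_,
    fun x => ?_, hfd, hfs⟩
  · rw [hconv]
    simp only [hw, if_pos hx]
    rw [mul_inv_cancel_left₀ hκ.ne', hgt]
    ring
  · rw [hconv, ← hFU]
    exact hFg x

theorem exists_punctured_smoothBdd_of_equation {a₁ a₂ δ : ℝ} (ha₁ : a₁ < 0) (ha₂ : 0 < a₂)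
    (hδ : 0 < δ) {K : ℝ → ℝ} {j : ℕ} {J : ℕ → ℝ → ℝ}
    (hJ : KernelTower j {0, δ, -δ} J (fun i => iteratedDeriv i K))
    (hJ0 : (a₁ < -(j * δ) ∧ j * δ < a₂) ∨ ∀ i < j, J i δ = 0 ∧ J i (-δ) = 0)
    {w R : ℝ → ℝ} (hwi : Integrable w) (hw2 : MemLp w 2) {κ : ℝ} (hκ : κ ≠ 0)
    (heq : ∀ x ∈ Ioo a₁ a₂, κ * w x = realConv K w x + R x) {T : Set ℝ} (hT : T.Finite)
    (hR : ∀ m < j, SmoothBdd m (Ioo a₁ a₂ \ T) R) :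
    ∃ ε > 0, SmoothBdd j (punctured ε) (realConv K w) := by
  have hV0 : IsOpen (Ioo a₁ a₂ \ T) := isOpen_Ioo.sdiff hT.isClosed
  rcases hJ0 with hij | hJ0
  -- Order n + 1 at x uses order n at x and at x ± δ. Thus `V n` contains the interval shortened by
  -- nδ at both ends, minus a finite set; at n = j the shortened interval still contains 0.
  · set V : ℕ → Set ℝ := fun n => Nat.rec (Ioo a₁ a₂ \ T)
      (fun _ W => W ∩ ({x | x - δ ∈ W} ∩ {x | x + δ ∈ W})) n with hV
    have hVs : ∀ n, V (n + 1) = V n ∩ ({x | x - δ ∈ V n} ∩ {x | x + δ ∈ V n}) := fun n => rfl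
    have hVo : ∀ n, IsOpen (V n) := by
      intro n
      induction n with
      | zero => exact hV0
      | succ n ih =>
        rw [hVs]
        exact ih.inter ((ih.preimage (continuous_id.sub continuous_const)).inter
          (ih.preimage (continuous_id.add continuous_const)))
    have hfin : ∀ n : ℕ, ∃ T' : Set ℝ, T'.Finite ∧
        Ioo (a₁ + n * δ) (a₂ - n * δ) \ T' ⊆ V n := by
      intro n
      induction n with
      | zero => exact ⟨T, hT, by simp [hV]⟩
      | succ n ih =>
        obtain ⟨T', hT', hsub⟩ := ih
        refine ⟨T' ∪ ((fun x => x + δ) '' T' ∪ (fun x => x - δ) '' T'),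
          hT'.union ((hT'.image _).union (hT'.image _)), ?_⟩
        rintro x ⟨hx, hxT⟩
        push_cast at hx
        simp only [mem_union, mem_image, not_or, not_exists, not_and] at hxT
        rw [hVs]
        refine ⟨hsub ⟨⟨?_, ?_⟩, hxT.1⟩, hsub ⟨⟨?_, ?_⟩, fun h => hxT.2.1 _ h (by ring)⟩,
          hsub ⟨⟨?_, ?_⟩, fun h => hxT.2.2 _ h (by ring)⟩⟩ <;> linarith [hx.1, hx.2]
    have hsb := hJ.smoothBdd_of_equation hw2 hwi hκ (R := R) (V := V) hVo
      (fun x hx => by simpa using heq x hx.1) hR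
      (antitone_nat_of_succ_le fun n => by rw [hVs]; exact inter_subset_left)
      (fun q hq _ n x hx => by
        rw [hVs] at hx
        simp only [Finset.mem_insert, Finset.mem_singleton] at hq
        rcases hq with rfl | rfl | rfl
        · simpa using hx.1
        · exact hx.2.1
        · simpa using hx.2.2) j le_rfl
    obtain ⟨T', hT', hsub⟩ := hfin j
    obtain ⟨ε, hε, hsubε⟩ := exists_punctured_subset
      (Ioo_mem_nhds (a := a₁ + j * δ) (b := a₂ - j * δ) (by linarith) (by linarith)) hT'
    exact ⟨ε, hε, by simpa using hsb.mono (hsubε.trans hsub)⟩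
  · obtain ⟨ε, hε, hsub⟩ := exists_punctured_subset (Ioo_mem_nhds ha₁ ha₂) hT
    refine ⟨ε, hε, ?_⟩
    have := hJ.smoothBdd_of_equation hw2 hwi hκ (R := R) (V := fun _ => punctured ε)
      (fun _ => isOpen_punctured ε) (fun x hx => by simpa using heq x (hsub hx).1)
      (fun m hm => (hR m hm).mono hsub) antitone_const
      (fun q hq ⟨i, hi, hne⟩ n x hx => by
        simp only [Finset.mem_insert, Finset.mem_singleton] at hq
        rcases hq with rfl | rfl | rfl
        · simpa using hx
        · exact absurd (hJ0 i hi).1 hne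
        · exact absurd (hJ0 i hi).2 hne) j le_rfl
    simpa using this

/-- A jump of the right-hand side is turned into a singular derivative of the solution. -/
theorem IsNlSolution.singular {a₁ a₂ δ : ℝ} (ha₁ : a₁ < 0) (ha₂ : 0 < a₂) (hδ : 0 < δ) {K : ℝ → ℝ}
    (h1 : KernelA1 K δ) (h2 : KernelA2 K δ) {j N : ℕ} (hN : j + 1 ≤ N)
    (hbdd : ∀ i < j, MemLp (iteratedDeriv i K) ⊤ volume)
    (hL2 : MemLp (iteratedDeriv j K) 2 volume)
    (hsing : UnboundedAtZero (iteratedDeriv j K)) {f b u : ℝ → ℝ} (hf : AssumptionB N a₁ a₂ f)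
    (hb : MemW12 (interior (nlCollar a₁ a₂ δ)) b)
    (hcase : a₁ < -(j * δ) ∧ j * δ < a₂ ∨
      (∀ i < j, Tendsto (iteratedDeriv i K) (𝓝[<] δ) (𝓝 0)) ∧ a₁ ≠ -δ ∧ a₂ ≠ δ)
    (hu : IsNlSolution K a₁ a₂ δ f b u) :
    ∃ v : ℝ → ℝ, v =ᵐ[volume.restrict (nlDomain a₁ a₂)] u ∧ ContDiffOffZero (j + 1) v ∧
      UnboundedAtZero (iteratedDeriv (j + 1) v) ∧
      (InfiniteAtZero (iteratedDeriv j K) → InfiniteAtZero (iteratedDeriv (j + 1) v)) := by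
  obtain ⟨N, rfl⟩ : ∃ n, N = n + 1 := ⟨N - 1, by omega⟩
  have haa : a₁ < a₂ := ha₁.trans ha₂
  obtain ⟨J, hJ, hJ0⟩ := h1.exists_kernelTower hδ h2 hbdd hL2
  have hK2 : MemLp K 2 := by simpa using hJ.memLp 0 (Nat.zero_le j)
  have hκ := h1.integral_pos hδ h2 hsing
  obtain ⟨w, wf, c, hwi, hw2, hc0, heq, hF, hfd, hfs⟩ :=
    hu.exists_primitive ha₁ ha₂ hδ h1 hK2 hκ hf hb
  set κ := ∫ t, K t with hκdef
  set S : Finset ℝ := {a₁ - δ, a₁, 0, a₂, a₂ + δ} with hS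
  -- Off this finite set every translate K(· - p) is smooth; as it contains 0, f' is covered too.
  set T : Set ℝ := ⋃ p ∈ S, (fun q => q + p) '' {0, δ, -δ} with hTdef
  have hT : T.Finite := S.finite_toSet.biUnion fun p _ => (Set.toFinite _).image _
  have hTp : ∀ p ∈ S, ∀ x ∉ T, x - p ∈ ({0, δ, -δ}ᶜ : Set ℝ) := fun p hp x hx hxp =>
    hx (mem_biUnion hp ⟨x - p, hxp, by ring⟩)
  have hV0 : IsOpen (Ioo a₁ a₂ \ T) := isOpen_Ioo.sdiff hT.isClosed
  have h0T : (0 : ℝ) ∈ T := mem_biUnion (show (0 : ℝ) ∈ S by simp [hS]) ⟨0, by simp, by simp⟩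
  have hVsub : Ioo a₁ a₂ \ T ⊆ Ioo a₁ 0 ∪ Ioo 0 a₂ := by
    rintro x ⟨hx, hxT⟩
    rcases lt_trichotomy x 0 with h | h | h
    · exact Or.inl ⟨hx.1, h⟩
    · exact absurd (h ▸ h0T) hxT
    · exact Or.inr ⟨h, hx.2⟩
  have hR : ∀ m < j, SmoothBdd m (Ioo a₁ a₂ \ T)
      (fun x => ∑ p ∈ S, c p * K (x - p) - wf x) := fun m hm =>
    (SmoothBdd.sum hV0 S fun p hp => (((h1.smoothBdd hδ h2 hbdd hL2 hm).comp_sub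
      fun x hx => hTp p hp x hx.2).const_mul (c p))).sub hV0
      ((hfs.mono hVsub).of_le (by omega))
  have hconv := exists_punctured_smoothBdd_of_equation ha₁ ha₂ hδ hJ
    (hcase.imp_right fun h i hi => hJ0 i hi (h.1 i hi)) hwi hw2 hκ.ne' heq hT hR
  refine ⟨fun x => κ⁻¹ * realConv K ((Ioo (a₁ - δ) (a₂ + δ)).indicator u) x + -κ⁻¹ * f x, ?_, ?_⟩
  · filter_upwards [hu.eqn, ae_restrict_mem measurableSet_Ioo] with x hx hxI
    rw [nlLaplacian_eq haa hδ h1 hK2 hu.memLp hxI] at hx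
    rw [← hx, ← hκdef]
    field_simp
    ring
  · have hm : 0 < min (-a₁) a₂ := lt_min (by linarith) ha₂
    have hsub : punctured (min (-a₁) a₂) ⊆ Ioo a₁ 0 ∪ Ioo 0 a₂ := by
      rintro x (hx | hx)
      · exact Or.inl ⟨by linarith [hx.1, min_le_left (-a₁) a₂], hx.2⟩
      · exact Or.inr ⟨hx.1, hx.2.trans_le (min_le_right _ _)⟩
    refine h1.singular_of_eq_primitive hδ h2 hsing (S := S) (c := c) (w := w) (lam := κ⁻¹)
      (h := fun x => -κ⁻¹ * f x) (h' := fun x => -κ⁻¹ * wf x) (inv_ne_zero hκ.ne') (by simp [hS])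
      hc0 (fun p hp hp0 => ?_) hwi hconv
      ⟨_, hm, ((hfs.mono hsub).of_le (by omega)).const_mul _⟩
      ⟨_, hm, fun x hx => (hfd x (hsub hx)).const_mul _⟩
      ⟨1, one_pos, fun x _ => by simp only [hF]⟩
    -- For j = 0 a boundary point may sit at ±δ. For j ≥ 1, case (i) gives δ ≤ jδ and so pushes both
    -- boundary points beyond ±δ, while case (ii) excludes these positions directly.
    by_cases hj : j = 0
    · exact Or.inr hj
    left
    have hsides : a₁ ≠ -δ ∧ a₂ ≠ δ := by
      rcases hcase with h | h
      · have : δ ≤ j * δ := le_mul_of_one_le_left hδ.le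
          (by exact_mod_cast Nat.one_le_iff_ne_zero.2 hj)
        exact ⟨by linarith, by linarith⟩
      · exact h.2
    simp only [hS, Finset.mem_insert, Finset.mem_singleton] at hp
    rcases hp with rfl | rfl | rfl | rfl | rfl
    · rw [abs_of_neg (by linarith)]; intro h; linarith
    · rw [abs_of_neg ha₁]; intro h; exact hsides.1 (by linarith)
    · exact absurd rfl hp0
    · rw [abs_of_pos ha₂]; exact hsides.2
    · rw [abs_of_pos (by linarith)]; intro h; linarith

end

theorem mainTheorem3 (a₁ a₂ δ : ℝ) (ha₁ : a₁ < 0) (ha₂ : 0 < a₂) (hδ : 0 < δ)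
    (K : ℝ → ℝ) (hA1 : KernelA1 K δ) (hA2 : KernelA2 K δ) (j N : ℕ) (hN : j + 1 ≤ N)
    (hbdd : ∀ i < j, MemLp (iteratedDeriv i K) ⊤ volume)
    (hL2 : MemLp (iteratedDeriv j K) 2 volume)
    (hsing : UnboundedAtZero (iteratedDeriv j K)) :
    (∀ f b u : ℝ → ℝ, AssumptionB N a₁ a₂ f → MemW12 (interior (nlCollar a₁ a₂ δ)) b →
      (a₁ < -(j * δ) ∧ j * δ < a₂ ∨
        (∀ i < j, Tendsto (iteratedDeriv i K) (𝓝[<] δ) (𝓝 0)) ∧ a₁ ≠ -δ ∧ a₂ ≠ δ) →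
      IsNlSolution K a₁ a₂ δ f b u →
      ∃ v : ℝ → ℝ, v =ᵐ[volume.restrict (nlDomain a₁ a₂)] u ∧
        ContDiffOffZero (j + 1) v ∧
        UnboundedAtZero (iteratedDeriv (j + 1) v) ∧
        (InfiniteAtZero (iteratedDeriv j K) → InfiniteAtZero (iteratedDeriv (j + 1) v))) ∧
    (∀ (u : ℝ → ℝ) (c₁ c₂ : ℝ), a₁ - δ ≤ c₁ → c₁ < -δ → δ < c₂ → c₂ ≤ a₂ + δ →
      MemLp u 2 (volume.restrict (nlDomain a₁ a₂ ∪ nlCollar a₁ a₂ δ)) →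
      AssumptionB N c₁ c₂ u →
      ContDiffOffZero (j + 1) (nlLaplacian K a₁ a₂ δ u) ∧
        UnboundedAtZero (iteratedDeriv (j + 1) (nlLaplacian K a₁ a₂ δ u)) ∧
        (InfiniteAtZero (iteratedDeriv j K) →
          InfiniteAtZero (iteratedDeriv (j + 1) (nlLaplacian K a₁ a₂ δ u)))) := by
  exact ⟨fun f b u hf hb hcase hu =>
      hu.singular ha₁ ha₂ hδ hA1 hA2 hN hbdd hL2 hsing hf hb hcase,
    fun u c₁ c₂ hac₁ hc₁ hc₂ hac₂ hu hB =>
      singular_nlLaplacian ha₁ ha₂ hδ hA1 hA2 hN hbdd hL2 hsing hac₁ hc₁ hc₂ hac₂ hu hB⟩
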